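/- **Generalized Euler angles.** For $N\ge 2$, $1\le j\le N-1$ and $1\le k\le 2j$ define the $N\times N$ matrices $$[\lambda_{j^2-1+k}]_{\mu\nu}=i\left(\delta_{\lceil k/2\rceil,\mu}\delta_{j+1,\nu}+\delta_{j+1,\mu}\delta_{\lceil k/2\rceil,\nu}\right)\ (k\text{ odd}),\qquad [\lambda_{j^2-1+k}]_{\mu\nu}=\delta_{k/2,\mu}\delta_{j+1,\nu}-\delta_{j+1,\mu}\delta_{k/2,\nu}\ (k\text{ even}),$$ $$\lambda_{(j+1)^2-1}=\mathrm{diag}(\underbrace{i,\dots,i}_{j},-ij,0,\dots,0),$$ and, for $2\le k\le N$, $A(k)(x,y)=e^{\lambda_3x}e^{\lambda_{(k-1)^2+1}y}$. Let $F_1\equiv 1$ and define inductively, for $\phi,\psi\in\mathbb R^{N(N-1)/2}$ and $\omega\in\mathbb R^{N-1}$, $$F_N(\phi,\psi,\omega)=A(2)(\phi_1,\psi_1)\,A(3)(\phi_2,\psi_2)\cdots A(N)(\phi_{N-1},\psi_{N-1})\begin{pmatrix}F_{N-1}(\phi',\psi',\omega')&0\\0&1\end{pmatrix}e^{\lambda_{N^2-1}\omega_{N-1}},$$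 where $\phi'=(\phi_N,\dots,\phi_{N(N-1)/2})$, $\psi'=(\psi_N,\dots,\psi_{N(N-1)/2})$ and $\omega'=(\omega_1,\dots,\omega_{N-2})$. Let $Q_N\subset\mathbb R^{N^2-1}$ be the closed hypercube of all $(\phi,\psi,\omega)$ with $$\phi\in\left([0,\pi]\times[0,2\pi]^{N-2}\right)\times\left([0,\pi]\times[0,2\pi]^{N-3}\right)\times\cdots\times\left([0,\pi]\times[0,2\pi]\right)\times[0,\pi],$$ $\psi_j\in[0,\tfrac{\pi}{2}]$ for $1\le j\le N(N-1)/2$, and $\omega_j\in[0,\tfrac{2\pi}{j}]$ for $1\le j\le N-1$. Then, for every $N\ge2$, $F_N$ maps $Q_N$ into $SU(N)$ and $F_N:Q_N\to SU(N)$ is surjective. Moreover, the restriction of $F_N$ to the interior of $Q_N$ is a $C^\infty$ diffeomorphism onto an open subset of $SU(N)$, where $SU(N)$ is regarded as an embedded submanifold of the space of complex $N\times N$ matrices. -/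

import Mathlib

open Set
open scoped ContDiff

/- Matrices are normed by the largest absolute value of an entry. All norms on this
finite-dimensional space are equivalent, and only smoothness is read off from it. -/
attribute [local instance] Matrix.normedAddCommGroup Matrix.normedSpace

/-- The generator `λ_m` of `𝔰𝔲(N)`, `1 ≤ m ≤ N ^ 2 - 1`. Every `m ≥ 1` is uniquely
`m = j ^ 2 - 1 + k` with `j ≥ 1` and `1 ≤ k ≤ 2 * j + 1`, namely `j = ⌊√m⌋`; the case
`k = 2 * j + 1` is `m = (j + 1) ^ 2 - 1`, the diagonal generator. Row and column indices in `Fin N`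
start at `0`, hence the `+ 1`; the number `(k + 1) / 2` is `⌈k / 2⌉`. -/
noncomputable def suGenerator (N m : ℕ) : Matrix (Fin N) (Fin N) ℂ :=
  let j : ℕ := Nat.sqrt m
  let k : ℕ := m + 1 - j ^ 2
  Matrix.of fun μ ν =>
    let a : ℕ := μ.val + 1
    let b : ℕ := ν.val + 1
    if k = 2 * j + 1 then
      if a = b then
        if a ≤ j then Complex.I else if a = j + 1 then -(Complex.I * (j : ℂ)) else 0
      else 0
    else if Odd k then
      Complex.I * ((if (k + 1) / 2 = a ∧ j + 1 = b then 1 else 0) +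
        (if j + 1 = a ∧ (k + 1) / 2 = b then 1 else 0))
    else
      (if k / 2 = a ∧ j + 1 = b then 1 else 0) - (if j + 1 = a ∧ k / 2 = b then 1 else 0)

/-- The matrix `A(k)(x, y) = exp (x λ_3) exp (y λ_{(k-1)^2+1})` of size `N`, for `2 ≤ k ≤ N`. -/
noncomputable def eulerFactor (N k : ℕ) (x y : ℝ) : Matrix (Fin N) (Fin N) ℂ :=
  NormedSpace.exp (x • suGenerator N 3) * NormedSpace.exp (y • suGenerator N ((k - 1) ^ 2 + 1))

/-- The block matrix with diagonal blocks `B` and `1`. -/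
noncomputable def addOne {n : ℕ} (B : Matrix (Fin n) (Fin n) ℂ) : Matrix (Fin (n + 1)) (Fin (n + 1)) ℂ :=
  Matrix.reindex finSumFinEquiv finSumFinEquiv
    (Matrix.fromBlocks B 0 0 (1 : Matrix (Fin 1) (Fin 1) ℂ))

/-- The number `N (N - 1) / 2` of angles `φ_j` (and of angles `ψ_j`). -/
abbrev numAngles (N : ℕ) : ℕ := N * (N - 1) / 2

theorem numAngles_succ (n : ℕ) : numAngles (n + 2) = (n + 1) + numAngles (n + 1) := by
  have h : (n + 2) * (n + 2 - 1) = 2 * (n + 1) + (n + 1) * (n + 1 - 1) := by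
    simp only [Nat.add_sub_cancel, show n + 2 - 1 = n + 1 from rfl]
    ring
  simp only [numAngles, h]
  omega

/-- The space of parameters `(φ, ψ, ω)`. The entries `φ_1, φ_2, …` of the mathematical notation
are `φ 0, φ 1, …`, and likewise for `ψ` and `ω`. -/
abbrev EulerParam (N : ℕ) : Type :=
  (Fin (numAngles N) → ℝ) × (Fin (numAngles N) → ℝ) × (Fin (N - 1) → ℝ)

/-- An index among `φ_1, …, φ_{N-1}`, where `N = n + 2`. -/
def headIdx {n : ℕ} (k : Fin (n + 1)) : Fin (numAngles (n + 2)) :=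
  ⟨k.val, by have := numAngles_succ n; omega⟩

/-- The index of `φ_{N-1+j}`, where `N = n + 2`. -/
def tailIdx {n : ℕ} (j : Fin (numAngles (n + 1))) : Fin (numAngles (n + 2)) :=
  ⟨(n + 1) + j.val, by have := numAngles_succ n; omega⟩

/-- The parameters `(φ_N, …, φ_{N(N-1)/2}, ψ_N, …, ψ_{N(N-1)/2}, ω_1, …, ω_{N-2})` that are
passed on to the map of index `N - 1`, where `N = n + 2`. -/
noncomputable def eulerTail {n : ℕ} (p : EulerParam (n + 2)) : EulerParam (n + 1) :=
  (fun j => p.1 (tailIdx j), fun j => p.2.1 (tailIdx j), fun j => p.2.2 (Fin.castSucc j))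

/-- The Euler map `F_N`. The value for `N = 0` is irrelevant. The ordered product in the third case
is `A(2)(φ_1, ψ_1) ⋯ A(N)(φ_{N-1}, ψ_{N-1})` with `N = n + 2`. -/
noncomputable def eulerMap : (N : ℕ) → EulerParam N → Matrix (Fin N) (Fin N) ℂ
  | 0, _ => 1
  | 1, _ => 1
  | n + 2, p =>
    (List.ofFn fun k : Fin (n + 1) =>
        eulerFactor (n + 2) (k.val + 2) (p.1 (headIdx k)) (p.2.1 (headIdx k))).prod
      * addOne (eulerMap (n + 1) (eulerTail p))
      * NormedSpace.exp (p.2.2 (Fin.last n) • suGenerator (n + 2) ((n + 2) ^ 2 - 1))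

/-- The upper end of the range of `φ_{i+1}` for `F_N`: the `φ`-angles come in consecutive blocks of
lengths `N - 1, N - 2, …, 1`; it is `π` for the first angle of a block and `2π` for the others. -/
noncomputable def phiUpper : ℕ → ℕ → ℝ
  | 0, _ => 0
  | 1, _ => 0
  | n + 2, i =>
    if i = 0 then Real.pi
    else if i < n + 1 then 2 * Real.pi
    else phiUpper (n + 1) (i - (n + 1))

/-- The closed hypercube of parameters:
`φ_j ∈ [0, π]` or `[0, 2π]`, `ψ_j ∈ [0, π / 2]`, `ω_j ∈ [0, 2π / j]`. -/
def eulerCube (N : ℕ) : Set (EulerParam N) :=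
  {p | (∀ i, p.1 i ∈ Icc 0 (phiUpper N i.val)) ∧
    (∀ i, p.2.1 i ∈ Icc 0 (Real.pi / 2)) ∧
    (∀ i, p.2.2 i ∈ Icc 0 (2 * Real.pi / ((i.val : ℝ) + 1)))}

/-- A map defined on an arbitrary subset `X` of a normed space is smooth if near each point of `X`
it extends to a `C^∞` map on an open set of the ambient space. If `X` is an open subset of an
embedded submanifold, this is smoothness for the induced manifold structure. -/
def IsSmoothOnSubset {E F : Type*} [NormedAddCommGroup E] [NormedSpace ℝ E]
    [NormedAddCommGroup F] [NormedSpace ℝ F] (f : E → F) (X : Set E) : Prop :=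
  ∀ x ∈ X, ∃ U : Set E, IsOpen U ∧ x ∈ U ∧
    ∃ g : E → F, ContDiffOn ℝ ∞ g U ∧ EqOn f g (U ∩ X)

/-- `f` restricts to a diffeomorphism of `X` onto `Y`: a smooth bijection with smooth inverse. -/
def IsDiffeoOnto {E F : Type*} [NormedAddCommGroup E] [NormedSpace ℝ E]
    [NormedAddCommGroup F] [NormedSpace ℝ F] (f : E → F) (X : Set E) (Y : Set F) : Prop :=
  BijOn f X Y ∧ IsSmoothOnSubset f X ∧
    ∃ g : F → E, InvOn g f X Y ∧ IsSmoothOnSubset g Y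

/-! The group SU(N) acts transitively on the unit sphere of ℂ^N, and the stabilizer of the last
basis vector is SU(N-1). The Euler map follows this fibration: in F_N the block F_{N-1} fixes the
last basis vector e, so the last column is A(2)⋯A(N) (d e) with d the phase contributed by the last
factor. The factor A(k) mixes coordinates 1 and k, and the factors to its left do not touch
coordinate k when k > 2, nor is there any factor to the left when k = 2. The equations for the
column are therefore triangular: each factor is governed by a Hopf-type map (φ, ψ, c) ↦ ℂ², where c
is the first coordinate handed on to the next factor.

Each Hopf-type map has an explicit section, everywhere defined with values in the closed range of
angles, and a genuine analytic inverse on the image of the open range (`hasSection_hopf`). Chaining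
these sections recovers the first block of angles and d from the column (`headProd_headInv`,
`headInv_spec`). Removing the outer factors leaves a unitary matrix that fixes e, hence a matrix of
SU(N-1), to which induction applies (`hasSection_recParam`).

The resulting section gives surjectivity. Since it is also a left inverse on the open cube and
analytic in the ambient matrix space, it gives the diffeomorphism and the openness of the image
without any Jacobian (`HasSection.exists_isDiffeoOnto`). -/

/-! ### Sections that are analytic inverses on an open part -/

/-- `g` is a section of `f` over `L` with values in `K`, and it inverts `f` on `O`, with `g` analytic
on the image of `O`. -/
structure HasSection {E F : Type*} [NormedAddCommGroup E] [NormedSpace ℝ E]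
    [NormedAddCommGroup F] [NormedSpace ℝ F] (f : E → F) (K O : Set E) (L : Set F)
    (g : F → E) : Prop where
  mapsTo : MapsTo g L K
  right : ∀ y ∈ L, f (g y) = y
  left : ∀ p ∈ O, g (f p) = p
  smooth : ∀ p ∈ O, ContDiffAt ℝ ω g (f p)

/-- Transport along bijective changes of coordinates. The closed domains need to be compared only
through `b'`, the open ones only through `b`. -/
theorem HasSection.conj {E E' F F' : Type*} [NormedAddCommGroup E] [NormedSpace ℝ E]
    [NormedAddCommGroup F] [NormedSpace ℝ F] [NormedAddCommGroup E'] [NormedSpace ℝ E']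
    [NormedAddCommGroup F'] [NormedSpace ℝ F'] {f : E → F} {K O : Set E} {g : F → E}
    (h : HasSection f K O univ g) {K' O' : Set E'} {b : E' → E} {b' : E → E'} {a : F → F'}
    {a' : F' → F} (hb : ∀ x, b (b' x) = x) (hb' : ∀ x, b' (b x) = x) (ha : ∀ x, a (a' x) = x)
    (ha' : ∀ x, a' (a x) = x) (hK : MapsTo b' K K') (hO : MapsTo b O' O)
    (sb : ContDiff ℝ ω b') (sa : ContDiff ℝ ω a') :
    HasSection (a ∘ f ∘ b) K' O' univ (b' ∘ g ∘ a') where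
  mapsTo := fun y _ => hK (h.mapsTo (mem_univ _))
  right := fun y _ => by simp [hb, h.right, ha]
  left := fun p hp => by simp [ha', h.left _ (hO hp), hb']
  smooth := fun p hp => by
    refine sb.contDiffAt.comp _ (ContDiffAt.comp _ ?_ sa.contDiffAt)
    simpa [ha'] using h.smooth _ (hO hp)

/-! ### Hopf-type coordinates on ℂ² -/

/-- The set of `(φ, ψ, c)` with `φ ∈ [0, u]` and `ψ ∈ [0, π / 2]`. -/
def closedAngles (u : ℝ) : Set (ℝ × ℝ × ℂ) :=
  {p | p.1 ∈ Icc 0 u ∧ p.2.1 ∈ Icc 0 (Real.pi / 2)}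

/-- The set of `(φ, ψ, c)` with `φ ∈ (0, u)`, `ψ ∈ (0, π / 2)` and `c ≠ 0`. -/
def openAngles (u : ℝ) : Set (ℝ × ℝ × ℂ) :=
  {p | p.1 ∈ Ioo 0 u ∧ p.2.1 ∈ Ioo 0 (Real.pi / 2) ∧ p.2.2 ≠ 0}

/-- The Hopf-type coordinates `(φ, ψ, c) ↦ (cos ψ e^{iφ} c, - sin ψ c)` on `ℂ²`. -/
noncomputable def hopf (p : ℝ × ℝ × ℂ) : ℂ × ℂ :=
  (Real.cos p.2.1 * Complex.exp (p.1 * Complex.I) * p.2.2, -(Real.sin p.2.1 * p.2.2))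

/-- The angle `φ ∈ [0, 2π]` of a point of `ℂ²` in the coordinates `hopf`. -/
noncomputable def hopfPhase (y : ℂ × ℂ) : ℝ := Complex.arg (y.1 / y.2) + Real.pi

/-- The angle `ψ ∈ [0, π / 2]` of a point of `ℂ²` in the coordinates `hopf`. -/
noncomputable def hopfAngle (y : ℂ × ℂ) : ℝ :=
  Real.arcsin (‖y.2‖ / Real.sqrt (‖y.1‖ ^ 2 + ‖y.2‖ ^ 2))

/-- A section of `hopf`. -/
noncomputable def hopfInv (y : ℂ × ℂ) : ℝ × ℝ × ℂ :=
  (hopfPhase y, hopfAngle y,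
    Complex.exp (-(hopfPhase y * Complex.I)) * Real.cos (hopfAngle y) * y.1
      - Real.sin (hopfAngle y) * y.2)

theorem arg_add_pi_mem_Icc (z : ℂ) : Complex.arg z + Real.pi ∈ Icc 0 (2 * Real.pi) :=
  ⟨by linarith [Complex.neg_pi_lt_arg z], by linarith [Complex.arg_le_pi z]⟩

theorem ofReal_norm_mul_exp_arg_add_pi (z : ℂ) :
    (‖z‖ : ℂ) * Complex.exp ((Complex.arg z + Real.pi : ℝ) * Complex.I) = -z := by
  rw [Complex.ofReal_add, add_mul, Complex.exp_add, Complex.exp_pi_mul_I, mul_neg_one, mul_neg,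
    Complex.norm_mul_exp_arg_mul_I]

/-- Negating the argument and adding π moves the branch cut of `arg` to the positive real axis, so
that all of (0, 2π) is covered analytically. -/
theorem arg_neg_mul_exp {r x : ℝ} (hr : 0 < r) (hx : x ∈ Ioo 0 (2 * Real.pi)) :
    Complex.arg (-(r * Complex.exp (x * Complex.I))) + Real.pi = x := by
  have : -(r * Complex.exp (x * Complex.I)) = r * Complex.exp ((x - Real.pi : ℝ) * Complex.I) := by
    rw [Complex.ofReal_sub, sub_mul, Complex.exp_sub, Complex.exp_pi_mul_I]; ring
  rw [this, Complex.arg_real_mul _ hr, Complex.exp_mul_I, ← Complex.ofReal_cos,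
    ← Complex.ofReal_sin, Complex.ofReal_cos, Complex.ofReal_sin,
    Complex.arg_cos_add_sin_mul_I ⟨by linarith [hx.1], by linarith [hx.2]⟩]
  ring

theorem neg_mul_exp_mem_slitPlane {r x : ℝ} (hr : 0 < r) (hx : x ∈ Ioo 0 (2 * Real.pi)) :
    -(r * Complex.exp (x * Complex.I)) ∈ Complex.slitPlane := by
  rw [Complex.mem_slitPlane_iff_arg]
  have h := arg_neg_mul_exp hr hx
  constructor
  · intro h1; rw [h1] at h; linarith [hx.2]
  · simp [hr.ne']

theorem contDiffAt_arg {z : ℂ} (hz : z ∈ Complex.slitPlane) : ContDiffAt ℝ ω Complex.arg z := by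
  have h := Complex.imCLM.contDiff.contDiffAt.comp z
    ((Complex.contDiffAt_log hz (n := ω)).restrict_scalars ℝ)
  exact h.congr_of_eventuallyEq (.of_forall fun x => (Complex.log_im x).symm)

theorem hopfAngle_mem (y : ℂ × ℂ) : hopfAngle y ∈ Icc 0 (Real.pi / 2) :=
  ⟨Real.arcsin_nonneg.2 (by positivity), Real.arcsin_le_pi_div_two _⟩

theorem sin_hopfAngle (y : ℂ × ℂ) :
    Real.sin (hopfAngle y) = ‖y.2‖ / Real.sqrt (‖y.1‖ ^ 2 + ‖y.2‖ ^ 2) := by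
  refine Real.sin_arcsin (neg_one_lt_zero.le.trans (by positivity)) (div_le_one_of_le₀ (Real.le_sqrt_of_sq_le ?_) (Real.sqrt_nonneg _))
  nlinarith [sq_nonneg ‖y.1‖]

/-- Multiplying out the square root makes the formula valid at y = 0 too, where the angle is only a
default value. -/
theorem sin_hopfAngle_mul (y : ℂ × ℂ) :
    Real.sin (hopfAngle y) * Real.sqrt (‖y.1‖ ^ 2 + ‖y.2‖ ^ 2) = ‖y.2‖ := by
  rw [sin_hopfAngle]
  refine div_mul_cancel_of_imp fun h => ?_
  rw [Real.sqrt_eq_zero (by positivity)] at h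
  nlinarith [sq_nonneg ‖y.1‖, sq_nonneg ‖y.2‖, pow_eq_zero_iff (two_ne_zero) |>.1
    (le_antisymm (by nlinarith [sq_nonneg ‖y.1‖]) (sq_nonneg ‖y.2‖))]

theorem cos_hopfAngle_mul (y : ℂ × ℂ) :
    Real.cos (hopfAngle y) * Real.sqrt (‖y.1‖ ^ 2 + ‖y.2‖ ^ 2) = ‖y.1‖ := by
  have h := hopfAngle_mem y
  have hc : 0 ≤ Real.cos (hopfAngle y) :=
    Real.cos_nonneg_of_mem_Icc ⟨by linarith [h.1, Real.pi_pos], h.2⟩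
  rw [← sq_eq_sq₀ (by positivity) (norm_nonneg _), mul_pow,
    Real.sq_sqrt (by positivity), Real.cos_sq']
  have h1 := congrArg (· ^ 2) (sin_hopfAngle_mul y)
  simp only [mul_pow, Real.sq_sqrt (add_nonneg (sq_nonneg ‖y.1‖) (sq_nonneg ‖y.2‖))] at h1
  linarith

/-- This says that y lies on the complex line spanned by the unit vector (cos ψ e^{iφ}, -sin ψ). The
third component of `hopfInv` is the Hermitian coefficient of y along that vector, so `hopf_hopfInv`
follows. -/
theorem cos_hopfAngle_mul_snd (y : ℂ × ℂ) :
    (Real.cos (hopfAngle y) : ℂ) * y.2 * Complex.exp (hopfPhase y * Complex.I)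
      = -(y.1 * Real.sin (hopfAngle y)) := by
  have key : (‖y.1‖ : ℂ) * y.2 * Complex.exp (hopfPhase y * Complex.I) = -(y.1 * ‖y.2‖) := by
    -- Here the phase is a default value coming from division by zero, but both sides vanish.
    by_cases hz : y.2 = 0
    · simp [hz]
    have h := ofReal_norm_mul_exp_arg_add_pi (y.1 / y.2)
    have hz' : (‖y.2‖ : ℂ) ≠ 0 := by simpa using hz
    rw [norm_div, Complex.ofReal_div] at h
    change _ * Complex.exp (hopfPhase y * Complex.I) = _ at h
    field_simp at h
    linear_combination h
  have h1 := cos_hopfAngle_mul y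
  have h2 := sin_hopfAngle_mul y
  generalize Real.sqrt (‖y.1‖ ^ 2 + ‖y.2‖ ^ 2) = R at h1 h2
  rw [← h1, ← h2] at key
  -- The radius R vanishes only at y = 0; otherwise it can be cancelled.
  by_cases hR : R = 0
  · rw [hR, mul_zero, eq_comm, norm_eq_zero] at h1 h2
    simp [h1, h2]
  · refine mul_right_cancel₀ (Complex.ofReal_ne_zero.2 hR) ?_
    push_cast at key ⊢
    linear_combination key

theorem hopf_hopfInv (y : ℂ × ℂ) : hopf (hopfInv y) = y := by
  have hK := cos_hopfAngle_mul_snd y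
  have h1 : Complex.exp (-(hopfPhase y * Complex.I)) * Complex.exp (hopfPhase y * Complex.I) = 1 := by
    rw [← Complex.exp_add]; simp
  have h2 : (Real.sin (hopfAngle y) : ℂ) ^ 2 + (Real.cos (hopfAngle y) : ℂ) ^ 2 = 1 := by
    exact_mod_cast Real.sin_sq_add_cos_sq (hopfAngle y)
  refine Prod.ext ?_ ?_
  · simp only [hopf, hopfInv]
    linear_combination (Real.cos (hopfAngle y) : ℂ) ^ 2 * y.1 * h1 - Real.sin (hopfAngle y) * hK
      + y.1 * h2
  · simp only [hopf, hopfInv]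
    linear_combination (-Real.cos (hopfAngle y) : ℂ) * Complex.exp (-(hopfPhase y * Complex.I)) * hK
      + (Real.cos (hopfAngle y) : ℂ) ^ 2 * y.2 * h1 + y.2 * h2

theorem trig_pos {p : ℝ × ℝ × ℂ} {u : ℝ} (hp : p ∈ openAngles u) :
    0 < Real.sin p.2.1 ∧ 0 < Real.cos p.2.1 :=
  ⟨Real.sin_pos_of_pos_of_lt_pi hp.2.1.1 (by linarith [hp.2.1.2, Real.pi_pos]),
    Real.cos_pos_of_mem_Ioo ⟨by linarith [hp.2.1.1, Real.pi_pos], hp.2.1.2⟩⟩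

/-- The quotient no longer involves c, and its sign is the one for which `hopfPhase` returns φ. -/
theorem hopf_div {p : ℝ × ℝ × ℂ} {u : ℝ} (hp : p ∈ openAngles u) :
    (hopf p).1 / (hopf p).2 =
      -((Real.cos p.2.1 / Real.sin p.2.1 : ℝ) * Complex.exp (p.1 * Complex.I)) := by
  have h1 : (Real.sin p.2.1 : ℂ) ≠ 0 := by exact_mod_cast (trig_pos hp).1.ne'
  have h2 := hp.2.2
  rw [Complex.ofReal_div]
  simp only [hopf]
  field_simp

theorem hopfPhase_hopf {p : ℝ × ℝ × ℂ} (hp : p ∈ openAngles (2 * Real.pi)) :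
    hopfPhase (hopf p) = p.1 := by
  rw [hopfPhase, hopf_div hp]
  exact arg_neg_mul_exp (div_pos (trig_pos hp).2 (trig_pos hp).1) hp.1

theorem norm_hopf {p : ℝ × ℝ × ℂ} {u : ℝ} (hp : p ∈ openAngles u) :
    ‖(hopf p).2‖ = Real.sin p.2.1 * ‖p.2.2‖ ∧
      Real.sqrt (‖(hopf p).1‖ ^ 2 + ‖(hopf p).2‖ ^ 2) = ‖p.2.2‖ := by
  have h2 : ‖(hopf p).2‖ = Real.sin p.2.1 * ‖p.2.2‖ := by
    simp only [hopf]
    rw [norm_neg, norm_mul, Complex.norm_of_nonneg (trig_pos hp).1.le]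
  refine ⟨h2, ?_⟩
  have h1 : ‖(hopf p).1‖ = Real.cos p.2.1 * ‖p.2.2‖ := by
    simp only [hopf]
    rw [norm_mul, norm_mul, Complex.norm_exp_ofReal_mul_I, Complex.norm_of_nonneg (trig_pos hp).2.le,
      mul_one]
  rw [h1, h2, ← Real.sqrt_sq (norm_nonneg p.2.2)]
  congr 1
  rw [Real.sqrt_sq (norm_nonneg p.2.2)]
  linear_combination ‖p.2.2‖ ^ 2 * Real.sin_sq_add_cos_sq p.2.1

theorem hopfAngle_hopf {p : ℝ × ℝ × ℂ} (hp : p ∈ openAngles (2 * Real.pi)) :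
    hopfAngle (hopf p) = p.2.1 := by
  rw [hopfAngle, (norm_hopf hp).2, (norm_hopf hp).1,
    mul_div_cancel_right₀ _ (norm_ne_zero_iff.2 hp.2.2)]
  exact Real.arcsin_sin (by linarith [hp.2.1.1, Real.pi_pos]) hp.2.1.2.le

theorem hopfInv_hopf {p : ℝ × ℝ × ℂ} (hp : p ∈ openAngles (2 * Real.pi)) :
    hopfInv (hopf p) = p := by
  refine Prod.ext (hopfPhase_hopf hp) (Prod.ext (hopfAngle_hopf hp) ?_)
  simp only [hopfInv, hopfPhase_hopf hp, hopfAngle_hopf hp]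
  simp only [hopf]
  have h1 : Complex.exp (-(p.1 * Complex.I)) * Complex.exp (p.1 * Complex.I) = 1 := by
    rw [← Complex.exp_add]; simp
  have h2 : (Real.sin p.2.1 : ℂ) ^ 2 + (Real.cos p.2.1 : ℂ) ^ 2 = 1 := by
    exact_mod_cast Real.sin_sq_add_cos_sq p.2.1
  linear_combination (Real.cos p.2.1 : ℂ) ^ 2 * p.2.2 * h1 + p.2.2 * h2

theorem contDiff_ofReal : ContDiff ℝ ω (fun x : ℝ => (x : ℂ)) := Complex.ofRealCLM.contDiff

theorem contDiff_cexp : ContDiff ℝ ω Complex.exp :=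
  (Complex.contDiff_exp (n := ω) (𝕜 := ℂ)).restrict_scalars ℝ

theorem contDiffAt_hopfInv {p : ℝ × ℝ × ℂ} (hp : p ∈ openAngles (2 * Real.pi)) :
    ContDiffAt ℝ ω hopfInv (hopf p) := by
  obtain ⟨hs, hc⟩ := trig_pos hp
  have h2 : (hopf p).2 ≠ 0 := by
    rw [← norm_ne_zero_iff, (norm_hopf hp).1]
    exact mul_ne_zero hs.ne' (norm_ne_zero_iff.2 hp.2.2)
  have sφ : ContDiffAt ℝ ω hopfPhase (hopf p) := by
    have hd : ContDiffAt ℝ ω (fun y : ℂ × ℂ => y.1 / y.2) (hopf p) := by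
      exact contDiffAt_fst.mul (contDiffAt_snd.inv h2)
    have ha : ContDiffAt ℝ ω Complex.arg ((hopf p).1 / (hopf p).2) := by
      rw [hopf_div hp]
      exact contDiffAt_arg (neg_mul_exp_mem_slitPlane (div_pos hc hs) hp.1)
    exact (ha.comp (hopf p) hd).add contDiffAt_const
  have sψ : ContDiffAt ℝ ω hopfAngle (hopf p) := by
    have hc1 : Real.sin p.2.1 < 1 := by
      nlinarith [Real.sin_sq_add_cos_sq p.2.1]
    have e : ‖(hopf p).2‖ / Real.sqrt (‖(hopf p).1‖ ^ 2 + ‖(hopf p).2‖ ^ 2) = Real.sin p.2.1 := by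
      rw [(norm_hopf hp).2, (norm_hopf hp).1, mul_div_cancel_right₀ _ (norm_ne_zero_iff.2 hp.2.2)]
    have ha : ContDiffAt ℝ ω Real.arcsin
        (‖(hopf p).2‖ / Real.sqrt (‖(hopf p).1‖ ^ 2 + ‖(hopf p).2‖ ^ 2)) :=
      Real.contDiffAt_arcsin (by rw [e]; linarith) (by rw [e]; linarith)
    refine ha.comp (f := fun y : ℂ × ℂ => ‖y.2‖ / Real.sqrt (‖y.1‖ ^ 2 + ‖y.2‖ ^ 2)) (hopf p) ?_
    have hn := (norm_hopf hp).2
    refine (contDiffAt_snd.norm ℝ h2).div (ContDiffAt.sqrt ?_ ?_) ?_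
    · exact (contDiffAt_fst.norm_sq ℝ).add (contDiffAt_snd.norm_sq ℝ)
    · intro h
      rw [h, Real.sqrt_zero] at hn
      exact hp.2.2 (norm_eq_zero.1 hn.symm)
    · rw [hn]
      exact norm_ne_zero_iff.2 hp.2.2
  have oR := contDiff_ofReal
  have hcos : ContDiff ℝ ω (fun x : ℝ => (Real.cos x : ℂ)) := oR.comp Real.contDiff_cos
  have hsin : ContDiff ℝ ω (fun x : ℝ => (Real.sin x : ℂ)) := oR.comp Real.contDiff_sin
  refine sφ.prodMk (sψ.prodMk (ContDiffAt.sub (ContDiffAt.mul (ContDiffAt.mul ?_ ?_)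
    contDiffAt_fst) (ContDiffAt.mul ?_ contDiffAt_snd)))
  · exact contDiff_cexp.contDiffAt.comp (hopf p)
      ((oR.contDiffAt.comp (hopf p) sφ).mul contDiffAt_const).neg
  · exact hcos.contDiffAt.comp (hopf p) sψ
  · exact hsin.contDiffAt.comp (hopf p) sψ

theorem hasSection_hopf :
    HasSection hopf (closedAngles (2 * Real.pi)) (openAngles (2 * Real.pi)) univ hopfInv where
  mapsTo := fun y _ => ⟨arg_add_pi_mem_Icc _, hopfAngle_mem y⟩
  right := fun y _ => hopf_hopfInv y
  left := fun _ hp => hopfInv_hopf hp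
  smooth := fun _ hp => contDiffAt_hopfInv hp

/-! ### The two-coordinate maps of a single factor -/

/-- The phase by which `exp (φ λ_3)` multiplies the basis vector of index `k + 1`. -/
noncomputable def twist (k : ℕ) (φ : ℝ) : ℂ := if k = 0 then Complex.exp (-(φ * Complex.I)) else 1

/-- The upper end of the range of the angle `φ_{k+1}` in the first block. -/
noncomputable def headUpper (k : ℕ) : ℝ := if k = 0 then Real.pi else 2 * Real.pi

/-- The coordinates of index `0` and `k + 1` of `A(k+2)(φ, ψ) (c e_0)`. -/
noncomputable def stepMap (k : ℕ) (p : ℝ × ℝ × ℂ) : ℂ × ℂ :=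
  (Real.cos p.2.1 * Complex.exp (p.1 * Complex.I) * p.2.2, -(Real.sin p.2.1 * twist k p.1 * p.2.2))

/-- The coordinates of index `0` and `k + 1` of `A(k+2)(φ, ψ) (c e_{k+1})`. -/
noncomputable def lastMap (k : ℕ) (p : ℝ × ℝ × ℂ) : ℂ × ℂ :=
  (Real.sin p.2.1 * Complex.exp (p.1 * Complex.I) * p.2.2, Real.cos p.2.1 * twist k p.1 * p.2.2)

theorem exists_hasSection_stepMap (k : ℕ) : ∃ g,
    HasSection (stepMap k) (closedAngles (headUpper k)) (openAngles (headUpper k)) univ g := by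
  by_cases hk : k = 0
  swap
  · refine ⟨hopfInv, ?_⟩
    have : stepMap k = hopf := by ext p <;> simp [stepMap, hopf, twist, hk]
    rw [this, headUpper, if_neg hk]
    exact hasSection_hopf
  subst hk
  -- For k = 0 the two coordinates carry opposite phases e^{iφ} and e^{-iφ}. Absorbing e^{-iφ} into
  -- c leaves the relative phase e^{2iφ}, which is why φ ranges only over [0, π].
  let b : ℝ × ℝ × ℂ → ℝ × ℝ × ℂ := fun p => (2 * p.1, p.2.1, Complex.exp (-(p.1 * Complex.I)) * p.2.2)
  let b' : ℝ × ℝ × ℂ → ℝ × ℝ × ℂ := fun p => (p.1 / 2, p.2.1, Complex.exp ((p.1 / 2 : ℝ) * Complex.I) * p.2.2)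
  have : stepMap 0 = id ∘ hopf ∘ b := by
    ext p
    · have h : Complex.exp (p.1 * Complex.I) =
          Complex.exp ((2 * p.1 : ℝ) * Complex.I) * Complex.exp (-(p.1 * Complex.I)) := by
        rw [← Complex.exp_add]; congr 1; push_cast; ring
      simp only [stepMap, Function.comp, id, hopf, b, h]
      ring
    · simp only [stepMap, Function.comp, id, hopf, b, twist, if_true]
      ring
  rw [this, headUpper, if_pos rfl]
  refine ⟨_, hasSection_hopf.conj (b := b) (b' := b') (a := id) (a' := id) ?_ ?_ ?_ ?_ ?_ ?_ ?_ ?_⟩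
  · rintro ⟨φ, ψ, c⟩
    simp only [b, b', Prod.mk.injEq, true_and, ← mul_assoc, ← Complex.exp_add]
    simp; ring
  · rintro ⟨φ, ψ, c⟩
    simp only [b, b', Prod.mk.injEq, true_and, ← mul_assoc, ← Complex.exp_add]
    simp
  · exact fun _ => rfl
  · exact fun _ => rfl
  · rintro p hp
    exact ⟨⟨by have := hp.1.1; simp only [b']; linarith, by have := hp.1.2; simp only [b']; linarith⟩, hp.2⟩
  · rintro p hp
    exact ⟨⟨by have := hp.1.1; simp only [b]; linarith, by have := hp.1.2; simp only [b]; linarith⟩, hp.2.1,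
      mul_ne_zero (Complex.exp_ne_zero _) hp.2.2⟩
  · have h1 : ContDiff ℝ ω (fun p : ℝ × ℝ × ℂ => p.1 / 2) := contDiff_fst.div_const 2
    exact h1.prodMk (contDiff_snd.fst.prodMk ((contDiff_cexp.comp
      ((contDiff_ofReal.comp h1).mul contDiff_const)).mul contDiff_snd.snd))
  · exact contDiff_id

/-- The reflection ψ ↦ π/2 - ψ exchanges sine and cosine; a sign in the second coordinate then
reduces this map to `stepMap`. -/
theorem exists_hasSection_lastMap (k : ℕ) : ∃ g,
    HasSection (lastMap k) (closedAngles (headUpper k)) (openAngles (headUpper k)) univ g := by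
  obtain ⟨g, hg⟩ := exists_hasSection_stepMap k
  let b : ℝ × ℝ × ℂ → ℝ × ℝ × ℂ := fun p => (p.1, Real.pi / 2 - p.2.1, p.2.2)
  let a : ℂ × ℂ → ℂ × ℂ := fun y => (y.1, -y.2)
  have : lastMap k = a ∘ stepMap k ∘ b := by
    ext p <;>
      simp [lastMap, stepMap, a, b, Complex.cos_pi_div_two_sub, Complex.sin_pi_div_two_sub]
  rw [this]
  refine ⟨_, hg.conj (b := b) (b' := b) (a := a) (a' := a) ?_ ?_ ?_ ?_ ?_ ?_ ?_ ?_⟩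
  · simp [b]
  · simp [b]
  · simp [a]
  · simp [a]
  · exact fun p hp => ⟨hp.1, by have := hp.2.2; simp only [b]; linarith,
      by have := hp.2.1; simp only [b]; linarith⟩
  · exact fun p hp => ⟨hp.1, ⟨by have := hp.2.1.2; simp only [b]; linarith,
      by have := hp.2.1.1; simp only [b]; linarith⟩, hp.2.2⟩
  · exact contDiff_fst.prodMk ((contDiff_const.sub contDiff_snd.fst).prodMk contDiff_snd.snd)
  · exact contDiff_fst.prodMk contDiff_snd.neg

theorem lastMap_fst_ne_zero {k : ℕ} {u : ℝ} {p : ℝ × ℝ × ℂ} (hp : p ∈ openAngles u) :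
    (lastMap k p).1 ≠ 0 :=
  mul_ne_zero (mul_ne_zero (Complex.ofReal_ne_zero.2 (trig_pos hp).1.ne') (Complex.exp_ne_zero _))
    hp.2.2

/-! ### The phase of the last factor -/

/-- The phase `e^{-i(n+1)x}`, by which the last factor multiplies the last basis vector. -/
noncomputable def lastPhase (n : ℕ) (x : ℝ) : ℂ := Complex.exp (-(((n + 1 : ℕ) * x : ℝ) * Complex.I))

/-- The inverse of `lastPhase n` on the unit circle, with values in `[0, 2π / (n + 1)]`. -/
noncomputable def lastPhaseInv (n : ℕ) (c : ℂ) : ℝ :=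
  (Complex.arg (-starRingEnd ℂ c) + Real.pi) / (n + 1 : ℕ)

theorem conj_lastPhase (n : ℕ) (x : ℝ) :
    starRingEnd ℂ (lastPhase n x) = Complex.exp (((n + 1 : ℕ) * x : ℝ) * Complex.I) := by
  rw [lastPhase, ← Complex.exp_conj]
  congr 1
  rw [map_neg, map_mul, Complex.conj_ofReal, Complex.conj_I]
  ring

theorem hasSection_lastPhase (n : ℕ) :
    HasSection (lastPhase n) (Icc 0 (2 * Real.pi / (n + 1 : ℕ))) (Ioo 0 (2 * Real.pi / (n + 1 : ℕ)))
      {c : ℂ | ‖c‖ = 1} (lastPhaseInv n) := by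
  have hn : (0 : ℝ) < (n + 1 : ℕ) := by positivity
  have hm : ∀ x ∈ Ioo 0 (2 * Real.pi / (n + 1 : ℕ)), (n + 1 : ℕ) * x ∈ Ioo 0 (2 * Real.pi) :=
    fun x hx => ⟨mul_pos hn hx.1, by rw [mul_comm]; exact (lt_div_iff₀ hn).1 hx.2⟩
  constructor
  · intro c _
    have := arg_add_pi_mem_Icc (-starRingEnd ℂ c)
    exact ⟨div_nonneg this.1 hn.le, div_le_div_of_nonneg_right this.2 hn.le⟩
  · intro c hc
    have h := ofReal_norm_mul_exp_arg_add_pi (-starRingEnd ℂ c)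
    rw [norm_neg, Complex.norm_conj, hc, Complex.ofReal_one, one_mul, neg_neg] at h
    rw [← Complex.conj_conj (lastPhase n _), conj_lastPhase, lastPhaseInv, mul_div_cancel₀ _ hn.ne', h,
      Complex.conj_conj]
  · intro x hx
    have h := arg_neg_mul_exp one_pos (hm x hx)
    rw [Complex.ofReal_one, one_mul] at h
    rw [lastPhaseInv, conj_lastPhase, h, mul_div_cancel_left₀ _ hn.ne']
  · intro x hx
    have h := neg_mul_exp_mem_slitPlane one_pos (hm x hx)
    rw [Complex.ofReal_one, one_mul, ← conj_lastPhase] at h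
    have h2 : ContDiffAt ℝ ω (fun c : ℂ => -starRingEnd ℂ c) (lastPhase n x) :=
      Complex.conjCLE.contDiff.neg.contDiffAt
    exact (((contDiffAt_arg h).comp (lastPhase n x) h2).add contDiffAt_const).div_const _

/-! ### Exponentials of the generators -/

open Matrix in
/-- The generator of rotations in the plane of the coordinates `a` and `b`. -/
def rotGen {N : ℕ} (a b : Fin N) : Matrix (Fin N) (Fin N) ℂ := single a b 1 - single b a 1

theorem rotGen_mul_self {N : ℕ} {a b : Fin N} (hab : a ≠ b) :
    rotGen a b * rotGen a b = -(Matrix.single a a 1 + Matrix.single b b 1) := by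
  simp [rotGen, sub_mul, mul_sub, hab, hab.symm]
  abel

theorem rotGen_cube {N : ℕ} {a b : Fin N} (hab : a ≠ b) :
    rotGen a b * rotGen a b * rotGen a b = -rotGen a b := by
  simp [rotGen, sub_mul, mul_sub, hab, hab.symm, neg_add_eq_sub]

theorem map_exp_matrix {A : Type*} [NormedRing A] [NormedAlgebra ℝ A] [CompleteSpace A] {N : ℕ}
    (f : A →+* Matrix (Fin N) (Fin N) ℂ) (hf : Continuous f) (x : A) :
    f (NormedSpace.exp x) = NormedSpace.exp (f x) := by
  let : NormedAlgebra ℚ A := NormedAlgebra.restrictScalars ℚ ℝ A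
  rw [NormedSpace.exp_eq_tsum ℝ, NormedSpace.exp_eq_tsum ℝ]
  refine ((NormedSpace.expSeries_summable' (𝕂 := ℝ) x).hasSum.map f hf).tsum_eq.symm.trans ?_
  dsimp only [Function.comp_def]
  simp_rw [map_inv_natCast_smul f ℝ ℝ, map_pow]

/-- The exponential of `y J` when `J ^ 3 = - J`. -/
theorem exp_smul_of_cube {N : ℕ} {J : Matrix (Fin N) (Fin N) ℂ} (hJ : J * J * J = -J) (y : ℝ) :
    NormedSpace.exp (y • J) = 1 + Real.sin y • J + (1 - Real.cos y) • (J * J) := by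
  have h1 : J * (J * J) = -J := by rw [← mul_assoc, hJ]
  -- The algebra ℝ[J] is a quotient of ℝ[X]/(X³ + X) ≅ ℂ × ℝ. Under `f` the element (i, 0) goes to
  -- J, so exp (yJ) is the image of (e^{iy}, 1).
  let f : ℂ × ℝ →+* Matrix (Fin N) (Fin N) ℂ :=
    { toFun := fun p => p.2 • 1 + p.1.im • J + (p.2 - p.1.re) • (J * J)
      map_one' := by simp
      map_zero' := by simp
      map_add' := fun p q => by
        simp only [Prod.snd_add, Prod.fst_add, Complex.add_re, Complex.add_im]
        module
      map_mul' := fun p q => by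
        have h2 : J * J * (J * J) = -(J * J) := by rw [← mul_assoc, hJ, neg_mul]
        simp only [add_mul, mul_add, smul_mul_assoc, mul_smul_comm, one_mul, mul_one, hJ, h1, h2,
          Prod.snd_mul, Prod.fst_mul, Complex.mul_re, Complex.mul_im]
        module }
  have hf : Continuous f := by
    change Continuous fun p : ℂ × ℝ => p.2 • (1 : Matrix (Fin N) (Fin N) ℂ) + p.1.im • J
      + (p.2 - p.1.re) • (J * J)
    fun_prop
  have h := map_exp_matrix f hf ((y * Complex.I : ℂ), (0 : ℝ))
  have e1 : f ((y * Complex.I : ℂ), (0 : ℝ)) = y • J := by simp [f]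
  have e2 : NormedSpace.exp ((y * Complex.I : ℂ), (0 : ℝ)) = (Complex.exp (y * Complex.I), 1) := by
    refine Prod.ext ?_ ?_
    · rw [Prod.fst_exp, Complex.exp_eq_exp_ℂ]
    · rw [Prod.snd_exp, NormedSpace.exp_zero]
  rw [e1, e2] at h
  rw [← h]
  simp [f]

theorem suGenerator_rot {n : ℕ} (k : Fin (n + 1)) :
    suGenerator (n + 2) ((k.val + 1) ^ 2 + 1) = rotGen 0 k.succ := by
  have h1 : Nat.sqrt ((k.val + 1) ^ 2 + 1) = k.val + 1 := by
    rw [Nat.sqrt_add_eq' _ (by omega)]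
  have h2 : (k.val + 1) ^ 2 + 1 + 1 - (k.val + 1) ^ 2 = 2 := by omega
  ext μ ν
  simp only [suGenerator, h1, h2, rotGen, Matrix.of_apply, Matrix.sub_apply, Matrix.single_apply,
    Fin.ext_iff, Fin.val_succ, Fin.val_zero]
  rw [if_neg (by omega), if_neg (by decide)]
  have h3 : ((0 : Fin (n + 2)) : ℕ) = 0 := rfl
  congr 1 <;> refine if_congr ?_ rfl rfl <;> omega

theorem suGenerator_diag (N j : ℕ) (hj : 1 ≤ j) :
    suGenerator N ((j + 1) ^ 2 - 1) = Matrix.diagonal fun μ : Fin N =>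
      if μ.val < j then Complex.I else if μ.val = j then -(Complex.I * (j : ℂ)) else 0 := by
  have h0 : (j + 1) ^ 2 - 1 = j ^ 2 + 2 * j := by
    have : (j + 1) ^ 2 = j ^ 2 + 2 * j + 1 := by ring
    omega
  have h1 : Nat.sqrt ((j + 1) ^ 2 - 1) = j := by
    rw [h0, Nat.sqrt_add_eq' _ (by omega)]
  have h2 : (j + 1) ^ 2 - 1 + 1 - j ^ 2 = 2 * j + 1 := by omega
  ext μ ν
  simp only [suGenerator, h1, h2, Matrix.of_apply, Matrix.diagonal_apply, if_true, Fin.ext_iff,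
    Nat.add_right_cancel_iff, Nat.add_one_le_iff]

theorem exp_diagonal_smul {N : ℕ} (d : Fin N → ℂ) (x : ℝ) :
    NormedSpace.exp (x • Matrix.diagonal d) = Matrix.diagonal fun i => Complex.exp (x * d i) := by
  rw [← Matrix.diagonal_smul, Matrix.exp_diagonal]
  congr 1
  ext i
  rw [Pi.coe_exp, Complex.exp_eq_exp_ℂ]
  simp

theorem exp_mem_unitaryGroup {N : ℕ} {X : Matrix (Fin N) (Fin N) ℂ} (hX : star X = -X) (x : ℝ) :
    NormedSpace.exp (x • X) ∈ Matrix.unitaryGroup (Fin N) ℂ := by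
  have hc : Commute (x • X) (-(x • X)) := by simp [Commute, SemiconjBy]
  rw [Matrix.mem_unitaryGroup_iff, Matrix.star_eq_conjTranspose, ← Matrix.exp_conjTranspose,
    Matrix.conjTranspose_smul, star_trivial, ← Matrix.star_eq_conjTranspose, hX, smul_neg,
    ← Matrix.exp_add_of_commute _ _ hc, add_neg_cancel,
    NormedSpace.exp_zero]

theorem star_rotGen {N : ℕ} (a b : Fin N) : star (rotGen a b) = -rotGen a b := by
  simp [rotGen, Matrix.star_eq_conjTranspose]

theorem exp_rotGen_mem {N : ℕ} {a b : Fin N} (hab : a ≠ b) (y : ℝ) :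
    NormedSpace.exp (y • rotGen a b) ∈ Matrix.specialUnitaryGroup (Fin N) ℂ := by
  have hU := exp_mem_unitaryGroup (star_rotGen a b)
  refine Matrix.mem_specialUnitaryGroup_iff.2 ⟨hU y, ?_⟩
  -- The half-angle exponential is real and unitary, so its determinant is real with square 1; the
  -- full exponential is its square.
  have hs : NormedSpace.exp (y • rotGen a b) =
      NormedSpace.exp ((y / 2) • rotGen a b) * NormedSpace.exp ((y / 2) • rotGen a b) := by
    rw [← Matrix.exp_add_of_commute _ _ (Commute.refl _), ← add_smul, add_halves]
  have hr : star (NormedSpace.exp ((y / 2) • rotGen a b)).det =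
      (NormedSpace.exp ((y / 2) • rotGen a b)).det := by
    rw [← starRingEnd_apply, RingHom.map_det]
    congr 1
    rw [exp_smul_of_cube (rotGen_cube hab), rotGen_mul_self hab]
    generalize Real.sin (y / 2) = s
    generalize Real.cos (y / 2) = c
    ext i j
    simp only [RingHom.mapMatrix_apply, Matrix.map_apply, rotGen, Matrix.add_apply,
      Matrix.smul_apply, Matrix.sub_apply, Matrix.neg_apply, Matrix.single_apply, Matrix.one_apply]
    split_ifs <;> simp
  have h := congrArg Matrix.det (Matrix.mem_unitaryGroup_iff.1 (hU (y / 2)))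
  rw [Matrix.det_mul, Matrix.star_eq_conjTranspose, Matrix.det_conjTranspose, hr, Matrix.det_one] at h
  rw [hs, Matrix.det_mul, h]

open Matrix in
theorem exp_rotGen_mulVec {N : ℕ} {a b : Fin N} (hab : a ≠ b) (y : ℝ) (v : Fin N → ℂ) :
    NormedSpace.exp (y • rotGen a b) *ᵥ v = v + Real.sin y • (Pi.single a (v b) - Pi.single b (v a))
      - (1 - Real.cos y) • (Pi.single a (v a) + Pi.single b (v b)) := by
  have hs : ∀ i j : Fin N, single i j (1 : ℂ) *ᵥ v = Pi.single i (v j) := fun i j => by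
    rw [single_mulVec, one_mul]; rfl
  rw [exp_smul_of_cube (rotGen_cube hab), rotGen_mul_self hab]
  simp only [add_mulVec, smul_mulVec, one_mulVec, rotGen, neg_mulVec, hs, smul_neg,
    sub_eq_add_neg]

/-- The diagonal of the generator `λ_{(j+1)^2-1}`. -/
noncomputable def diagEntry (j μ : ℕ) : ℂ :=
  if μ < j then Complex.I else if μ = j then -(Complex.I * (j : ℂ)) else 0

theorem exp_suGenerator_diag (N j : ℕ) (hj : 1 ≤ j) (x : ℝ) :
    NormedSpace.exp (x • suGenerator N ((j + 1) ^ 2 - 1)) =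
      Matrix.diagonal fun μ : Fin N => Complex.exp (x * diagEntry j μ) := by
  rw [suGenerator_diag N j hj]
  exact exp_diagonal_smul (fun μ : Fin N => diagEntry j μ) x

theorem exp_suGenerator_three (N : ℕ) (x : ℝ) :
    NormedSpace.exp (x • suGenerator N 3) =
      Matrix.diagonal fun μ : Fin N => Complex.exp (x * diagEntry 1 μ) :=
  exp_suGenerator_diag N 1 le_rfl x

/-- Vanishing of the trace, which makes the determinant of the exponential equal to 1. -/
theorem sum_diagEntry (n j : ℕ) (hj : j < n) : ∑ μ : Fin n, diagEntry j μ = 0 := by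
  rw [Fin.sum_univ_eq_sum_range (diagEntry j) n]
  induction n, Nat.succ_le_of_lt hj using Nat.le_induction with
  | base =>
    rw [Nat.succ_eq_add_one, Finset.sum_range_succ,
      Finset.sum_congr (f := diagEntry j) (g := fun _ => Complex.I) rfl fun i hi => if_pos (Finset.mem_range.1 hi)]
    simp [diagEntry]
    ring
  | succ m hm ih =>
    rw [Finset.sum_range_succ, ih hm, diagEntry, if_neg (by omega), if_neg (by omega), add_zero]

theorem exp_suGenerator_diag_mem (N j : ℕ) (hj : 1 ≤ j) (hN : j < N) (x : ℝ) :
    NormedSpace.exp (x • suGenerator N ((j + 1) ^ 2 - 1)) ∈ Matrix.specialUnitaryGroup (Fin N) ℂ := by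
  refine Matrix.mem_specialUnitaryGroup_iff.2 ⟨exp_mem_unitaryGroup ?_ x, ?_⟩
  · rw [suGenerator_diag N j hj, Matrix.star_eq_conjTranspose, Matrix.diagonal_conjTranspose,
      Matrix.diagonal_neg]
    congr 1
    ext i
    simp only [Pi.star_apply]
    split_ifs <;> simp
  · rw [exp_suGenerator_diag N j hj, Matrix.det_diagonal, ← Complex.exp_sum, ← Finset.mul_sum,
      sum_diagEntry N j hN, mul_zero, Complex.exp_zero]

/-! ### Action of one Euler factor on basis vectors -/

theorem eulerFactor_eq (n : ℕ) (k : Fin (n + 1)) (x y : ℝ) :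
    eulerFactor (n + 2) (k.val + 2) x y =
      NormedSpace.exp (x • suGenerator (n + 2) 3) * NormedSpace.exp (y • rotGen 0 k.succ) := by
  rw [← suGenerator_rot]
  rfl

theorem eulerFactor_mem (n : ℕ) (k : Fin (n + 1)) (x y : ℝ) :
    eulerFactor (n + 2) (k.val + 2) x y ∈ Matrix.specialUnitaryGroup (Fin (n + 2)) ℂ := by
  rw [eulerFactor_eq]
  exact mul_mem (exp_suGenerator_diag_mem _ 1 le_rfl (by omega) x)
    (exp_rotGen_mem (Fin.succ_ne_zero k).symm y)

open Matrix in
theorem exp_suGenerator_three_mulVec_single (N : ℕ) (x : ℝ) (i : Fin N) (c : ℂ) :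
    NormedSpace.exp (x • suGenerator N 3) *ᵥ Pi.single i c =
      Pi.single i (Complex.exp (x * diagEntry 1 i) * c) := by
  rw [exp_suGenerator_three, diagonal_mulVec_single]

theorem exp_diagEntry_one_succ (x : ℝ) (k : ℕ) :
    Complex.exp (x * diagEntry 1 (k + 1)) = twist k x := by
  rcases k with _ | k <;> simp [diagEntry, twist]

theorem exp_diagEntry_one_zero (x : ℝ) :
    Complex.exp (x * diagEntry 1 0) = Complex.exp (x * Complex.I) := by
  simp [diagEntry]

open Matrix in
theorem eulerFactor_mulVec_zero (n : ℕ) (k : Fin (n + 1)) (x y : ℝ) (c : ℂ) :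
    eulerFactor (n + 2) (k.val + 2) x y *ᵥ Pi.single 0 c =
      Pi.single 0 (stepMap k (x, y, c)).1 + Pi.single k.succ (stepMap k (x, y, c)).2 := by
  have h0 := (Fin.succ_ne_zero k)
  have : NormedSpace.exp (y • rotGen 0 k.succ) *ᵥ Pi.single 0 c =
      Pi.single 0 (Real.cos y * c) + Pi.single k.succ (-(Real.sin y * c)) := by
    rw [exp_rotGen_mulVec h0.symm, Pi.single_eq_same, Pi.single_eq_of_ne h0]
    ext i
    rcases eq_or_ne i 0 with rfl | h1
    · simp [h0.symm]; ring
    · rcases eq_or_ne i k.succ with rfl | h2 <;> simp [*]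
  rw [eulerFactor_eq, ← mulVec_mulVec, this, mulVec_add, exp_suGenerator_three_mulVec_single,
    exp_suGenerator_three_mulVec_single, Fin.val_succ, exp_diagEntry_one_succ, Fin.val_zero,
    exp_diagEntry_one_zero]
  simp only [stepMap]
  congr 2 <;> ring

open Matrix in
theorem eulerFactor_mulVec_succ (n : ℕ) (k : Fin (n + 1)) (x y : ℝ) (c : ℂ) :
    eulerFactor (n + 2) (k.val + 2) x y *ᵥ Pi.single k.succ c =
      Pi.single 0 (lastMap k (x, y, c)).1 + Pi.single k.succ (lastMap k (x, y, c)).2 := by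
  have h0 := (Fin.succ_ne_zero k)
  have : NormedSpace.exp (y • rotGen 0 k.succ) *ᵥ Pi.single k.succ c =
      Pi.single 0 (Real.sin y * c) + Pi.single k.succ (Real.cos y * c) := by
    rw [exp_rotGen_mulVec h0.symm, Pi.single_eq_same, Pi.single_eq_of_ne h0.symm]
    ext i
    rcases eq_or_ne i 0 with rfl | h1
    · simp [h0.symm]
    · rcases eq_or_ne i k.succ with rfl | h2
      · simp [*]; ring
      · simp [*]
  rw [eulerFactor_eq, ← mulVec_mulVec, this, mulVec_add, exp_suGenerator_three_mulVec_single,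
    exp_suGenerator_three_mulVec_single, Fin.val_succ, exp_diagEntry_one_succ, Fin.val_zero,
    exp_diagEntry_one_zero]
  simp only [lastMap]
  congr 2 <;> ring

open Matrix in
theorem eulerFactor_mulVec_of_lt (n : ℕ) (k : Fin (n + 1)) (x y : ℝ) (c : ℂ) {i : Fin (n + 2)}
    (hi : k.val + 1 < i.val) :
    eulerFactor (n + 2) (k.val + 2) x y *ᵥ Pi.single i c = Pi.single i c := by
  have h0 : 0 ≠ i := fun h => by subst h; simp at hi
  have h1 : k.succ ≠ i := fun h => by subst h; simp at hi
  rw [eulerFactor_eq, ← mulVec_mulVec, exp_rotGen_mulVec (Fin.succ_ne_zero k).symm,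
    Pi.single_eq_of_ne h0, Pi.single_eq_of_ne h1]
  simp only [Pi.single_zero, sub_zero, smul_zero, add_zero]
  rw [exp_suGenerator_three_mulVec_single, diagEntry, if_neg (by omega), if_neg (by omega)]
  simp

/-! ### The ordered product of Euler factors -/

/-- The product `A(2)(φ_0, ψ_0) ⋯ A(m+1)(φ_{m-1}, ψ_{m-1})` of matrices of size `n + 2`. -/
noncomputable def headProd (n m : ℕ) (φ ψ : ℕ → ℝ) : Matrix (Fin (n + 2)) (Fin (n + 2)) ℂ :=
  (List.ofFn fun k : Fin m => eulerFactor (n + 2) (k.val + 2) (φ k) (ψ k)).prod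

theorem headProd_zero (n : ℕ) (φ ψ : ℕ → ℝ) : headProd n 0 φ ψ = 1 := by
  simp [headProd]

theorem headProd_succ (n m : ℕ) (φ ψ : ℕ → ℝ) :
    headProd n (m + 1) φ ψ = headProd n m φ ψ * eulerFactor (n + 2) (m + 2) (φ m) (ψ m) := by
  rw [headProd, List.ofFn_succ']
  simp [headProd]

theorem headProd_mem (n m : ℕ) (hm : m ≤ n + 1) (φ ψ : ℕ → ℝ) :
    headProd n m φ ψ ∈ Matrix.specialUnitaryGroup (Fin (n + 2)) ℂ := by
  induction m with
  | zero => rw [headProd_zero]; exact one_mem _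
  | succ m ih =>
    rw [headProd_succ]
    exact mul_mem (ih (by omega)) (eulerFactor_mem n ⟨m, by omega⟩ _ _)

open Matrix in
theorem headProd_mulVec_of_lt (n m : ℕ) (hm : m ≤ n + 1) (φ ψ : ℕ → ℝ) {i : Fin (n + 2)}
    (hi : m < i.val) (c : ℂ) : headProd n m φ ψ *ᵥ Pi.single i c = Pi.single i c := by
  induction m with
  | zero => rw [headProd_zero, one_mulVec]
  | succ m ih =>
    rw [headProd_succ, ← mulVec_mulVec,
      eulerFactor_mulVec_of_lt n ⟨m, by omega⟩ (φ m) (ψ m) c hi, ih (by omega) (by omega)]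

-- The number c k is the first coordinate still to be processed by the k leftmost factors. The
-- factor of index k splits c (k + 1) into c k and the final coordinate v (k + 1), which the
-- remaining factors leave alone.
open Matrix in
theorem headProd_mulVec_zero (n m : ℕ) (hm : m ≤ n + 1) (φ ψ : ℕ → ℝ) (c v : ℕ → ℂ)
    (h0 : v 0 = c 0) (h : ∀ k < m, stepMap k (φ k, ψ k, c (k + 1)) = (c k, v (k + 1))) :
    headProd n m φ ψ *ᵥ Pi.single 0 (c m) = fun i : Fin (n + 2) => if i.val ≤ m then v i else 0 := by
  induction m with
  | zero =>
    rw [headProd_zero, one_mulVec]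
    ext i
    rcases eq_or_ne i 0 with rfl | hi
    · simp [h0]
    · rw [Pi.single_eq_of_ne hi, if_neg]
      have := Fin.val_ne_of_ne hi
      simpa using this
  | succ m ih =>
    rw [headProd_succ, ← mulVec_mulVec,
      eulerFactor_mulVec_zero n ⟨m, by omega⟩ (φ m) (ψ m) (c (m + 1))]
    simp only [h m (by omega)]
    rw [mulVec_add, ih (by omega) (fun k hk => h k (by omega)),
      headProd_mulVec_of_lt n m (by omega) φ ψ (by simp)]
    ext i
    rcases eq_or_ne i (Fin.succ ⟨m, by omega⟩) with rfl | hi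
    · simp
    · have hi' : i.val ≠ m + 1 := fun h => hi (Fin.ext (by simpa using h))
      rw [Pi.add_apply, Pi.single_eq_of_ne hi, add_zero]
      exact if_congr (by omega) rfl rfl

-- The rightmost factor starts from the last basis vector instead of the first, hence `lastMap`
-- there and `stepMap` for all the others.
open Matrix in
theorem headProd_mulVec_last (n : ℕ) (φ ψ : ℕ → ℝ) (c v : ℕ → ℂ) (d : ℂ)
    (h0 : v 0 = c 0) (h : ∀ k < n, stepMap k (φ k, ψ k, c (k + 1)) = (c k, v (k + 1)))
    (hn : lastMap n (φ n, ψ n, d) = (c n, v (n + 1))) :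
    headProd n (n + 1) φ ψ *ᵥ Pi.single (Fin.last (n + 1)) d = fun i : Fin (n + 2) => v i := by
  have e := eulerFactor_mulVec_succ n (Fin.last n) (φ n) (ψ n) d
  simp only [Fin.val_last, hn] at e
  rw [headProd_succ, ← mulVec_mulVec, ← Fin.succ_last, e, mulVec_add, headProd_mulVec_zero n n (by omega) φ ψ c v h0 h,
    headProd_mulVec_of_lt n n (by omega) φ ψ (by simp)]
  ext i
  rcases eq_or_ne i (Fin.succ (Fin.last n)) with rfl | hi
  · simp
  · have hi' : i.val ≠ n + 1 := fun h => hi (Fin.ext (by simpa using h))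
    rw [Pi.add_apply, Pi.single_eq_of_ne hi, add_zero, if_pos (by omega)]

/-! ### Recovering the first block of angles from a column -/

/-- A section of `stepMap k`. -/
noncomputable def stepInv (k : ℕ) : ℂ × ℂ → ℝ × ℝ × ℂ := (exists_hasSection_stepMap k).choose

theorem hasSection_stepMap (k : ℕ) : HasSection (stepMap k) (closedAngles (headUpper k))
    (openAngles (headUpper k)) univ (stepInv k) := (exists_hasSection_stepMap k).choose_spec

/-- A section of `lastMap k`. -/
noncomputable def lastInv (k : ℕ) : ℂ × ℂ → ℝ × ℝ × ℂ := (exists_hasSection_lastMap k).choose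

theorem hasSection_lastMap (k : ℕ) : HasSection (lastMap k) (closedAngles (headUpper k))
    (openAngles (headUpper k)) univ (lastInv k) := (exists_hasSection_lastMap k).choose_spec

/-- The coordinate of index `0` of the vector obtained from `v` by applying the inverses of
`A(2), …, A(k+1)`. -/
noncomputable def peel (v : ℕ → ℂ) : ℕ → ℂ
  | 0 => v 0
  | k + 1 => (stepInv k (peel v k, v (k + 1))).2.2

/-- The angles of index `k` recovered from the last column `v`, with the remaining coordinate. -/
noncomputable def headInv (n : ℕ) (v : ℕ → ℂ) (k : ℕ) : ℝ × ℝ × ℂ :=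
  if k = n then lastInv k (peel v k, v (k + 1)) else stepInv k (peel v k, v (k + 1))

theorem headInv_mem (n : ℕ) (v : ℕ → ℂ) (k : ℕ) : headInv n v k ∈ closedAngles (headUpper k) := by
  rw [headInv]
  split_ifs
  · exact (hasSection_lastMap k).mapsTo (mem_univ _)
  · exact (hasSection_stepMap k).mapsTo (mem_univ _)

open Matrix in
theorem headProd_headInv (n : ℕ) (v : ℕ → ℂ) :
    headProd n (n + 1) (fun k => (headInv n v k).1) (fun k => (headInv n v k).2.1) *ᵥ
      Pi.single (Fin.last (n + 1)) (headInv n v n).2.2 = fun i : Fin (n + 2) => v i := by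
  refine headProd_mulVec_last n _ _ (peel v) v _ rfl (fun k hk => ?_) ?_
  · simp only [headInv, if_neg hk.ne, peel]
    exact (hasSection_stepMap k).right _ (mem_univ _)
  · simp only [headInv, if_true]
    exact (hasSection_lastMap n).right _ (mem_univ _)

/-- The angles of index at most `n` lie in the interiors of their ranges. -/
def OpenHead (n : ℕ) (φ ψ : ℕ → ℝ) : Prop :=
  ∀ k ≤ n, φ k ∈ Ioo 0 (headUpper k) ∧ ψ k ∈ Ioo 0 (Real.pi / 2)

-- Forward evaluation of the chain for given angles. In the open range every cosine is nonzero, so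
-- no c k vanishes and every triple lies where the sections are true inverses.
open Matrix in
theorem exists_chain {n : ℕ} {φ ψ : ℕ → ℝ} {d : ℂ} (h : OpenHead n φ ψ) (hd : d ≠ 0) {v : ℕ → ℂ}
    (hv : headProd n (n + 1) φ ψ *ᵥ Pi.single (Fin.last (n + 1)) d = fun i : Fin (n + 2) => v i) :
    ∃ c : ℕ → ℂ, v 0 = c 0 ∧ (∀ k < n, stepMap k (φ k, ψ k, c (k + 1)) = (c k, v (k + 1))) ∧
      lastMap n (φ n, ψ n, d) = (c n, v (n + 1)) ∧ ∀ k ≤ n, c k ≠ 0 := by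
  let a : ℕ → ℂ := fun l => Real.cos (ψ l) * Complex.exp (φ l * Complex.I)
  -- Solving the first components downward from index n: each step multiplies by cos ψ e^{iφ}.
  let c : ℕ → ℂ := fun k => (∏ l ∈ Finset.Ico k n, a l) * (lastMap n (φ n, ψ n, d)).1
  let w : ℕ → ℂ := fun i => if i = 0 then c 0 else
    if i = n + 1 then (lastMap n (φ n, ψ n, d)).2 else
      (stepMap (i - 1) (φ (i - 1), ψ (i - 1), c i)).2
  have hcn : c n = (lastMap n (φ n, ψ n, d)).1 := by simp [c]
  have hstep : ∀ k < n, stepMap k (φ k, ψ k, c (k + 1)) = (c k, w (k + 1)) := fun k hk => by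
    refine Prod.ext ?_ ?_
    · simp only [stepMap, c, Finset.prod_eq_prod_Ico_succ_bot hk, a]
      ring
    · simp [w, hk.ne]
  have hlast : lastMap n (φ n, ψ n, d) = (c n, w (n + 1)) := by
    refine Prod.ext hcn.symm ?_
    simp [w]
  have hw := headProd_mulVec_last n φ ψ c w d (by simp [w]) hstep hlast
  rw [hv] at hw
  have hvw : ∀ i ≤ n + 1, v i = w i := fun i hi => congrFun hw ⟨i, by omega⟩
  refine ⟨c, by rw [hvw 0 (by omega)]; simp [w], fun k hk => ?_, ?_, fun k _ => ?_⟩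
  · rw [hstep k hk, hvw _ (by omega)]
  · rw [hlast, hvw _ le_rfl]
  · refine mul_ne_zero (Finset.prod_ne_zero_iff.2 fun l hl => ?_)
      (lastMap_fst_ne_zero (u := headUpper n) ⟨(h n le_rfl).1, (h n le_rfl).2, hd⟩)
    have hl' := h l (Finset.mem_Ico.1 hl).2.le
    have := (trig_pos (p := (φ l, ψ l, 1)) ⟨hl'.1, hl'.2, one_ne_zero⟩).2
    exact mul_ne_zero (Complex.ofReal_ne_zero.2 this.ne') (Complex.exp_ne_zero _)

-- By induction `peel` agrees with the chain of `exists_chain`, so each local section is used at a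
-- point where it is an analytic inverse.
open Matrix in
theorem headInv_spec {F : Type*} [NormedAddCommGroup F] [NormedSpace ℝ F] {n : ℕ} {φ ψ : ℕ → ℝ}
    {d : ℂ} (h : OpenHead n φ ψ) (hd : d ≠ 0) {v : F → ℕ → ℂ} {x : F}
    (hv : headProd n (n + 1) φ ψ *ᵥ Pi.single (Fin.last (n + 1)) d = fun i : Fin (n + 2) => v x i)
    (sv : ∀ i, ContDiffAt ℝ ω (fun y => v y i) x) {k : ℕ} (hk : k ≤ n) :
    (headInv n (v x) k).1 = φ k ∧ (headInv n (v x) k).2.1 = ψ k ∧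
      (headInv n (v x) n).2.2 = d ∧ ContDiffAt ℝ ω (fun y => headInv n (v y) k) x := by
  obtain ⟨c, h0, hs, hl, hc⟩ := exists_chain h hd hv
  have hO : ∀ k < n, (φ k, ψ k, c (k + 1)) ∈ openAngles (headUpper k) :=
    fun k hk => ⟨(h k hk.le).1, (h k hk.le).2, hc _ hk⟩
  have hOn : (φ n, ψ n, d) ∈ openAngles (headUpper n) := ⟨(h n le_rfl).1, (h n le_rfl).2, hd⟩
  have hp : ∀ k ≤ n, peel (v x) k = c k ∧ ContDiffAt ℝ ω (fun y => peel (v y) k) x := by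
    intro k
    induction k with
    | zero => exact fun _ => ⟨h0, sv 0⟩
    | succ k ih =>
      intro hk
      obtain ⟨e, s⟩ := ih (by omega)
      have hx : stepMap k (φ k, ψ k, c (k + 1)) = (peel (v x) k, v x (k + 1)) := by
        rw [hs k hk, e]
      have hsm := (hasSection_stepMap k).smooth _ (hO k hk)
      rw [hx] at hsm
      refine ⟨?_, (hsm.comp x (s.prodMk (sv (k + 1)))).snd.snd⟩
      rw [peel, ← hx, (hasSection_stepMap k).left _ (hO k hk)]
  have hxn : lastMap n (φ n, ψ n, d) = (peel (v x) n, v x (n + 1)) := by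
    rw [hl, (hp n le_rfl).1]
  have en : headInv n (v x) n = (φ n, ψ n, d) := by
    rw [headInv, if_pos rfl, ← hxn, (hasSection_lastMap n).left _ hOn]
  obtain rfl | hk' := eq_or_lt_of_le hk
  · have hsm := (hasSection_lastMap k).smooth _ hOn
    rw [hxn] at hsm
    refine ⟨by rw [en], by rw [en], by rw [en], ?_⟩
    simp only [headInv, if_true]
    exact hsm.comp x ((hp k le_rfl).2.prodMk (sv (k + 1)))
  · have hx : stepMap k (φ k, ψ k, c (k + 1)) = (peel (v x) k, v x (k + 1)) := by
      rw [hs k hk', (hp k hk).1]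
    have ek : headInv n (v x) k = (φ k, ψ k, c (k + 1)) := by
      rw [headInv, if_neg hk'.ne, ← hx, (hasSection_stepMap k).left _ (hO k hk')]
    have hsm := (hasSection_stepMap k).smooth _ (hO k hk')
    rw [hx] at hsm
    refine ⟨by rw [ek], by rw [ek], by rw [en], ?_⟩
    simp only [headInv, if_neg hk'.ne]
    exact hsm.comp x ((hp k hk).2.prodMk (sv (k + 1)))

/-! ### Smoothness of matrix-valued maps -/

section Smooth

variable {E : Type*} [NormedAddCommGroup E] [NormedSpace ℝ E] {r : WithTop ℕ∞} {x : E} {N N' : ℕ}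

theorem contDiffAt_matrix {f : E → Matrix (Fin N) (Fin N') ℂ} :
    ContDiffAt ℝ r f x ↔ ∀ i j, ContDiffAt ℝ r (fun y => f y i j) x := by
  have h : ContDiffAt ℝ r f x ↔ ∀ i, ContDiffAt ℝ r (fun y => f y i) x :=
    contDiffAt_pi (Φ := fun y i => f y i)
  rw [h]
  exact forall_congr' fun i => contDiffAt_pi

theorem ContDiffAt.matrix_mul {f g : E → Matrix (Fin N) (Fin N) ℂ} (hf : ContDiffAt ℝ r f x)
    (hg : ContDiffAt ℝ r g x) : ContDiffAt ℝ r (fun y => f y * g y) x := by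
  rw [contDiffAt_matrix] at hf hg ⊢
  intro i j
  simp only [Matrix.mul_apply]
  exact ContDiffAt.sum fun k _ => (hf i k).mul (hg k j)

theorem ContDiffAt.matrix_star {f : E → Matrix (Fin N) (Fin N) ℂ} (hf : ContDiffAt ℝ r f x) :
    ContDiffAt ℝ r (fun y => star (f y)) x := by
  rw [contDiffAt_matrix] at hf ⊢
  exact fun i j => Complex.conjCLE.contDiff.contDiffAt.comp x (hf j i)

theorem contDiffAt_exp_suGenerator_diag {j : ℕ} (hj : 1 ≤ j) {f : E → ℝ}
    (hf : ContDiffAt ℝ ω f x) :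
    ContDiffAt ℝ ω (fun y => NormedSpace.exp (f y • suGenerator N ((j + 1) ^ 2 - 1))) x := by
  simp only [exp_suGenerator_diag N j hj]
  refine contDiffAt_matrix.2 fun i k => ?_
  simp only [Matrix.diagonal_apply]
  split_ifs
  · exact contDiff_cexp.contDiffAt.comp x
      ((contDiff_ofReal.contDiffAt.comp x hf).mul contDiffAt_const)
  · exact contDiffAt_const

theorem contDiffAt_exp_rotGen {a b : Fin N} (hab : a ≠ b) {f : E → ℝ} (hf : ContDiffAt ℝ ω f x) :
    ContDiffAt ℝ ω (fun y => NormedSpace.exp (f y • rotGen a b)) x := by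
  simp only [exp_smul_of_cube (rotGen_cube hab)]
  exact (contDiffAt_const.add (hf.sin.smul contDiffAt_const)).add
    ((contDiffAt_const.sub hf.cos).smul contDiffAt_const)

theorem contDiffAt_headProd {n m : ℕ} (hm : m ≤ n + 1) {φ ψ : E → ℕ → ℝ}
    (hφ : ∀ k < m, ContDiffAt ℝ ω (fun y => φ y k) x)
    (hψ : ∀ k < m, ContDiffAt ℝ ω (fun y => ψ y k) x) :
    ContDiffAt ℝ ω (fun y => headProd n m (φ y) (ψ y)) x := by
  induction m with
  | zero => simp only [headProd_zero]; exact contDiffAt_const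
  | succ m ih =>
    simp only [headProd_succ]
    refine (ih (by omega) (fun k hk => hφ k (by omega)) fun k hk => hψ k (by omega)).matrix_mul ?_
    have e := eulerFactor_eq n ⟨m, by omega⟩
    simp only at e
    simp only [e]
    exact (contDiffAt_exp_suGenerator_diag (j := 1) le_rfl (hφ m (by omega))).matrix_mul
      (contDiffAt_exp_rotGen (Fin.succ_ne_zero _).symm (hψ m (by omega)))

end Smooth

/-! ### Block matrices with a trailing 1 -/

section AddOne

variable {n : ℕ}

theorem addOne_castSucc (B : Matrix (Fin n) (Fin n) ℂ) (i j : Fin n) :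
    addOne B i.castSucc j.castSucc = B i j := by
  simp [addOne]

theorem addOne_castSucc_last (B : Matrix (Fin n) (Fin n) ℂ) (i : Fin n) :
    addOne B i.castSucc (Fin.last n) = 0 := by
  simp [addOne]

theorem addOne_last_castSucc (B : Matrix (Fin n) (Fin n) ℂ) (i : Fin n) :
    addOne B (Fin.last n) i.castSucc = 0 := by
  simp [addOne]

theorem addOne_last_last (B : Matrix (Fin n) (Fin n) ℂ) :
    addOne B (Fin.last n) (Fin.last n) = 1 := by
  simp [addOne]

/-- The upper left block of size `n`. -/
def corner (M : Matrix (Fin (n + 1)) (Fin (n + 1)) ℂ) : Matrix (Fin n) (Fin n) ℂ :=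
  M.submatrix Fin.castSucc Fin.castSucc

theorem corner_addOne (B : Matrix (Fin n) (Fin n) ℂ) : corner (addOne B) = B := by
  ext i j
  exact addOne_castSucc B i j

theorem addOne_mul (A B : Matrix (Fin n) (Fin n) ℂ) : addOne (A * B) = addOne A * addOne B := by
  simp [addOne, Matrix.submatrix_mul_equiv, Matrix.fromBlocks_multiply]

theorem star_addOne (A : Matrix (Fin n) (Fin n) ℂ) : star (addOne A) = addOne (star A) := by
  simp [addOne, Matrix.star_eq_conjTranspose, Matrix.fromBlocks_conjTranspose]

theorem addOne_one : addOne (1 : Matrix (Fin n) (Fin n) ℂ) = 1 := by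
  simp [addOne]

theorem det_addOne (A : Matrix (Fin n) (Fin n) ℂ) : (addOne A).det = A.det := by
  simp [addOne]

theorem addOne_mem_iff (A : Matrix (Fin n) (Fin n) ℂ) :
    addOne A ∈ Matrix.specialUnitaryGroup (Fin (n + 1)) ℂ ↔
      A ∈ Matrix.specialUnitaryGroup (Fin n) ℂ := by
  have hinj : Function.Injective (addOne (n := n)) := Function.LeftInverse.injective corner_addOne
  rw [Matrix.mem_specialUnitaryGroup_iff, Matrix.mem_specialUnitaryGroup_iff, det_addOne,
    Matrix.mem_unitaryGroup_iff, Matrix.mem_unitaryGroup_iff, star_addOne, ← addOne_mul, ← addOne_one,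
    hinj.eq_iff]

open Matrix in
theorem addOne_mulVec_last (A : Matrix (Fin n) (Fin n) ℂ) (c : ℂ) :
    addOne A *ᵥ Pi.single (Fin.last n) c = Pi.single (Fin.last n) c := by
  ext i
  rw [mulVec_single]
  refine Fin.lastCases ?_ (fun i => ?_) i
  · simp [addOne_last_last]
  · simp [addOne_castSucc_last, Fin.castSucc_ne_last]

open Matrix in
/-- A unitary matrix that fixes the last basis vector has block form. -/
theorem addOne_corner {M : Matrix (Fin (n + 1)) (Fin (n + 1)) ℂ}
    (hM : M ∈ Matrix.unitaryGroup (Fin (n + 1)) ℂ)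
    (h : M *ᵥ Pi.single (Fin.last n) 1 = Pi.single (Fin.last n) 1) : addOne (corner M) = M := by
  -- The column condition gives the last column of M; unitarity passes it to the adjoint, which
  -- gives the last row.
  have hs : star M *ᵥ Pi.single (Fin.last n) 1 = Pi.single (Fin.last n) 1 := by
    conv_lhs => rw [← h]
    rw [mulVec_mulVec, Matrix.mem_unitaryGroup_iff'.1 hM, one_mulVec]
  have h1 : ∀ i, M i (Fin.last n) = (Pi.single (Fin.last n) 1 : Fin (n + 1) → ℂ) i := fun i => by
    rw [← h]; simp
  have h2 : ∀ j, M (Fin.last n) j = (Pi.single (Fin.last n) 1 : Fin (n + 1) → ℂ) j := fun j => by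
    have := congrFun hs j
    simp only [mulVec_single_one, col_apply, star_apply] at this
    rw [← star_star (M _ _), this]
    rcases eq_or_ne j (Fin.last n) with rfl | hj <;> simp [*]
  ext i j
  refine Fin.lastCases ?_ (fun i => ?_) i
  · refine Fin.lastCases ?_ (fun j => ?_) j
    · simp [addOne_last_last, h1]
    · simp [addOne_last_castSucc, h2, Fin.castSucc_ne_last]
  · refine Fin.lastCases ?_ (fun j => ?_) j
    · simp [addOne_castSucc_last, h1, Fin.castSucc_ne_last]
    · simp [addOne_castSucc, corner]

end AddOne

theorem contDiffAt_addOne {E : Type*} [NormedAddCommGroup E] [NormedSpace ℝ E] {r : WithTop ℕ∞}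
    {x : E} {n : ℕ} {f : E → Matrix (Fin n) (Fin n) ℂ} (hf : ContDiffAt ℝ r f x) :
    ContDiffAt ℝ r (fun y => addOne (f y)) x := by
  rw [contDiffAt_matrix] at hf ⊢
  intro i j
  refine Fin.lastCases ?_ (fun i => ?_) i <;> refine Fin.lastCases ?_ (fun j => ?_) j
  · simp only [addOne_last_last]; exact contDiffAt_const
  · simp only [addOne_last_castSucc]; exact contDiffAt_const
  · simp only [addOne_castSucc_last]; exact contDiffAt_const
  · simp only [addOne_castSucc]; exact hf i j

theorem contDiffAt_corner {E : Type*} [NormedAddCommGroup E] [NormedSpace ℝ E] {r : WithTop ℕ∞}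
    {x : E} {n : ℕ} {f : E → Matrix (Fin (n + 1)) (Fin (n + 1)) ℂ} (hf : ContDiffAt ℝ r f x) :
    ContDiffAt ℝ r (fun y => corner (f y)) x := by
  rw [contDiffAt_matrix] at hf ⊢
  exact fun i j => hf i.castSucc j.castSucc

/-! ### Recursive structure of the Euler map and of its parameters -/

/-- The last factor `exp (w λ_{N^2-1})` of the Euler map for `N = n + 2`. -/
noncomputable def lastFactor (n : ℕ) (w : ℝ) : Matrix (Fin (n + 2)) (Fin (n + 2)) ℂ :=
  NormedSpace.exp (w • suGenerator (n + 2) ((n + 2) ^ 2 - 1))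

theorem lastFactor_mem (n : ℕ) (w : ℝ) :
    lastFactor n w ∈ Matrix.specialUnitaryGroup (Fin (n + 2)) ℂ :=
  exp_suGenerator_diag_mem (n + 2) (n + 1) (by omega) (by omega) w

theorem lastFactor_eq (n : ℕ) (w : ℝ) : lastFactor n w =
    Matrix.diagonal fun μ : Fin (n + 2) => Complex.exp (w * diagEntry (n + 1) μ) :=
  exp_suGenerator_diag (n + 2) (n + 1) (by omega) w

theorem exp_diagEntry_last (n : ℕ) (w : ℝ) :
    Complex.exp (w * diagEntry (n + 1) (n + 1)) = lastPhase n w := by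
  rw [lastPhase, diagEntry, if_neg (lt_irrefl _), if_pos rfl]
  congr 1
  push_cast
  ring

open Matrix in
theorem lastFactor_mulVec (n : ℕ) (w : ℝ) (c : ℂ) :
    lastFactor n w *ᵥ Pi.single (Fin.last (n + 1)) c =
      Pi.single (Fin.last (n + 1)) (lastPhase n w * c) := by
  rw [lastFactor_eq, diagonal_mulVec_single, Fin.val_last, exp_diagEntry_last]

open Matrix in
theorem star_lastFactor_mulVec (n : ℕ) (w : ℝ) (c : ℂ) :
    star (lastFactor n w) *ᵥ Pi.single (Fin.last (n + 1)) c =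
      Pi.single (Fin.last (n + 1)) (star (lastPhase n w) * c) := by
  rw [lastFactor_eq, star_eq_conjTranspose, diagonal_conjTranspose, diagonal_mulVec_single,
    Pi.star_apply, Fin.val_last, exp_diagEntry_last]

/-- The angles `φ_{k+1}`, `ψ_{k+1}` of the first block, as sequences. -/
noncomputable def headSeq {n : ℕ} (φ : Fin (numAngles (n + 2)) → ℝ) (k : ℕ) : ℝ :=
  φ (headIdx (Fin.ofNat (n + 1) k))

theorem eulerMap_succ {n : ℕ} (p : EulerParam (n + 2)) :
    eulerMap (n + 2) p = headProd n (n + 1) (headSeq p.1) (headSeq p.2.1)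
      * addOne (eulerMap (n + 1) (eulerTail p)) * lastFactor n (p.2.2 (Fin.last n)) := by
  rw [eulerMap, headProd]
  simp only [headSeq, Fin.ofNat_val_eq_self, lastFactor]

theorem eulerMap_mem (n : ℕ) (p : EulerParam (n + 1)) :
    eulerMap (n + 1) p ∈ Matrix.specialUnitaryGroup (Fin (n + 1)) ℂ := by
  induction n with
  | zero => exact one_mem _
  | succ n ih =>
    rw [eulerMap_succ]
    exact mul_mem (mul_mem (headProd_mem n (n + 1) le_rfl _ _) ((addOne_mem_iff _).2 (ih _)))
      (lastFactor_mem n _)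

theorem contDiff_eulerTail (n : ℕ) : ContDiff ℝ ω (eulerTail (n := n)) := by
  refine ContDiff.prodMk ?_ (ContDiff.prodMk ?_ ?_) <;> refine contDiff_pi.2 fun i => ?_ <;> fun_prop

theorem contDiff_eulerMap (n : ℕ) : ContDiff ℝ ω (eulerMap (n + 1)) := by
  induction n with
  | zero => exact contDiff_const
  | succ n ih =>
    refine contDiff_iff_contDiffAt.2 fun p => ?_
    have e : eulerMap (n + 2) = fun p => headProd n (n + 1) (headSeq p.1) (headSeq p.2.1)
      * addOne (eulerMap (n + 1) (eulerTail p)) * lastFactor n (p.2.2 (Fin.last n)) :=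
      funext eulerMap_succ
    rw [e]
    refine ((contDiffAt_headProd le_rfl (fun k _ => ?_) fun k _ => ?_).matrix_mul
      (contDiffAt_addOne (ih.comp (contDiff_eulerTail n)).contDiffAt)).matrix_mul
      (contDiffAt_exp_suGenerator_diag (j := n + 1) (by omega) ?_)
    · simp only [headSeq]; fun_prop
    · simp only [headSeq]; fun_prop
    · fun_prop

/-- The angles with first block `a` and remaining blocks `t`. -/
def joinAngles {n : ℕ} (a : ℕ → ℝ) (t : Fin (numAngles (n + 1)) → ℝ) :
    Fin (numAngles (n + 2)) → ℝ := fun i =>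
  if h : i.val < n + 1 then a i else t ⟨i.val - (n + 1), by have := numAngles_succ n; omega⟩

theorem headSeq_joinAngles {n : ℕ} (a : ℕ → ℝ) (t : Fin (numAngles (n + 1)) → ℝ) {k : ℕ}
    (hk : k < n + 1) : headSeq (joinAngles a t) k = a k := by
  have : (headIdx (Fin.ofNat (n + 1) k)).val = k := by simp [headIdx, Nat.mod_eq_of_lt hk]
  simp only [headSeq, joinAngles, this, hk, dif_pos]

theorem joinAngles_tailIdx {n : ℕ} (a : ℕ → ℝ) (t : Fin (numAngles (n + 1)) → ℝ)
    (j : Fin (numAngles (n + 1))) : joinAngles a t (tailIdx j) = t j := by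
  have hv : (tailIdx j).val = n + 1 + j.val := rfl
  rw [joinAngles, dif_neg (by omega)]
  congr 1
  ext
  simp only [hv]
  omega

theorem joinAngles_self {n : ℕ} (φ : Fin (numAngles (n + 2)) → ℝ) {a : ℕ → ℝ}
    (ha : ∀ k < n + 1, a k = headSeq φ k) : joinAngles a (fun j => φ (tailIdx j)) = φ := by
  ext i
  by_cases h : i.val < n + 1
  · simp only [joinAngles, h, dif_pos, ha, headSeq]
    congr 1
    ext
    simp [headIdx, Nat.mod_eq_of_lt h]
  · simp only [joinAngles, h, dif_neg, not_false_eq_true]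
    congr 1
    ext
    simp only [tailIdx]
    omega

/-- The parameters with angles `a`, `b` in the first block, last angle `w` and remaining
parameters `t`. -/
noncomputable def joinParam {n : ℕ} (a b : ℕ → ℝ) (w : ℝ) (t : EulerParam (n + 1)) :
    EulerParam (n + 2) :=
  (joinAngles a t.1, joinAngles b t.2.1, Fin.snoc (α := fun _ => ℝ) t.2.2 w)

theorem eulerTail_joinParam {n : ℕ} (a b : ℕ → ℝ) (w : ℝ) (t : EulerParam (n + 1)) :
    eulerTail (joinParam a b w t) = t := by
  refine Prod.ext (funext fun j => joinAngles_tailIdx _ _ _)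
    (Prod.ext (funext fun j => joinAngles_tailIdx _ _ _) (funext fun j => ?_))
  exact Fin.snoc_castSucc (α := fun _ => ℝ) _ _ j

theorem headProd_congr {n m : ℕ} {φ φ' ψ ψ' : ℕ → ℝ} (h : ∀ k < m, φ k = φ' k)
    (h' : ∀ k < m, ψ k = ψ' k) : headProd n m φ ψ = headProd n m φ' ψ' := by
  unfold headProd
  congr 2
  ext k : 1
  rw [h k k.2, h' k k.2]

theorem eulerMap_joinParam {n : ℕ} (a b : ℕ → ℝ) (w : ℝ) (t : EulerParam (n + 1)) :
    eulerMap (n + 2) (joinParam a b w t) =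
      headProd n (n + 1) a b * addOne (eulerMap (n + 1) t) * lastFactor n w := by
  rw [eulerMap_succ, eulerTail_joinParam]
  have h1 : headProd n (n + 1) (headSeq (joinParam a b w t).1) (headSeq (joinParam a b w t).2.1) =
      headProd n (n + 1) a b :=
    headProd_congr (fun k hk => headSeq_joinAngles a t.1 hk) fun k hk => headSeq_joinAngles b t.2.1 hk
  have h2 : (joinParam a b w t).2.2 (Fin.last n) = w := Fin.snoc_last (α := fun _ => ℝ) _ _
  rw [h1, h2]

theorem joinParam_self {n : ℕ} (p : EulerParam (n + 2)) {a b : ℕ → ℝ}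
    (ha : ∀ k < n + 1, a k = headSeq p.1 k) (hb : ∀ k < n + 1, b k = headSeq p.2.1 k) :
    joinParam a b (p.2.2 (Fin.last n)) (eulerTail p) = p := by
  refine Prod.ext (joinAngles_self _ ha) (Prod.ext (joinAngles_self _ hb) ?_)
  exact Fin.snoc_init_self (α := fun _ => ℝ) (n := n) p.2.2

theorem phiUpper_head {n k : ℕ} (hk : k < n + 1) : phiUpper (n + 2) k = headUpper k := by
  simp [phiUpper, headUpper, hk]

theorem phiUpper_tail (n j : ℕ) : phiUpper (n + 2) (n + 1 + j) = phiUpper (n + 1) j := by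
  rw [phiUpper, if_neg (by omega), if_neg (by omega), Nat.add_sub_cancel_left]

theorem joinParam_mem {n : ℕ} {a b : ℕ → ℝ} {w : ℝ} {t : EulerParam (n + 1)}
    (ha : ∀ k, a k ∈ Icc 0 (headUpper k)) (hb : ∀ k, b k ∈ Icc 0 (Real.pi / 2))
    (hw : w ∈ Icc 0 (2 * Real.pi / (n + 1 : ℕ))) (ht : t ∈ eulerCube (n + 1)) :
    joinParam a b w t ∈ eulerCube (n + 2) := by
  refine ⟨fun i => ?_, fun i => ?_, fun i => ?_⟩
  · simp only [joinParam, joinAngles]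
    split_ifs with h
    · rw [phiUpper_head h]; exact ha i
    · have := ht.1 ⟨i.val - (n + 1), by have := numAngles_succ n; omega⟩
      rw [← phiUpper_tail, Nat.add_sub_cancel' (by omega)] at this
      exact this
  · simp only [joinParam, joinAngles]
    split_ifs
    · exact hb i
    · exact ht.2.1 _
  · refine Fin.lastCases (n := n) ?_ (fun j => ?_) i
    · simp only [joinParam, Fin.snoc_last (α := fun _ => ℝ)]
      simpa using hw
    · simp only [joinParam, Fin.snoc_castSucc (α := fun _ => ℝ)]
      exact ht.2.2 j

/-! ### The open cube -/

/-- The open hypercube of parameters. -/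
def openEulerCube (N : ℕ) : Set (EulerParam N) :=
  {p | (∀ i, p.1 i ∈ Ioo 0 (phiUpper N i.val)) ∧
    (∀ i, p.2.1 i ∈ Ioo 0 (Real.pi / 2)) ∧
    (∀ i, p.2.2 i ∈ Ioo 0 (2 * Real.pi / ((i.val : ℝ) + 1)))}

theorem interior_eulerCube_subset (N : ℕ) : interior (eulerCube N) ⊆ openEulerCube N := by
  have e : eulerCube N = (univ.pi fun i : Fin (numAngles N) => Icc 0 (phiUpper N i.val)) ×ˢ
      ((univ.pi fun _ : Fin (numAngles N) => Icc 0 (Real.pi / 2)) ×ˢ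
        (univ.pi fun i : Fin (N - 1) => Icc 0 (2 * Real.pi / ((i.val : ℝ) + 1)))) := by
    ext p
    simp only [eulerCube, mem_ofPred_eq, mem_prod, mem_univ_pi]
  rw [e, interior_prod_eq, interior_prod_eq, interior_pi_set finite_univ,
    interior_pi_set finite_univ, interior_pi_set finite_univ]
  simp only [interior_Icc]
  intro p hp
  simp only [mem_prod, mem_univ_pi] at hp
  exact hp

theorem openHead_of_mem {n : ℕ} {p : EulerParam (n + 2)} (hp : p ∈ openEulerCube (n + 2)) :
    OpenHead n (headSeq p.1) (headSeq p.2.1) := by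
  refine fun k hk => ⟨?_, hp.2.1 _⟩
  have := hp.1 (headIdx (Fin.ofNat (n + 1) k))
  have e : (headIdx (Fin.ofNat (n + 1) k)).val = k := by
    simp [headIdx, Nat.mod_eq_of_lt (Nat.lt_succ_of_le hk)]
  rwa [e, phiUpper_head (by omega)] at this

theorem eulerTail_mem {n : ℕ} {p : EulerParam (n + 2)} (hp : p ∈ openEulerCube (n + 2)) :
    eulerTail p ∈ openEulerCube (n + 1) := by
  refine ⟨fun i => ?_, fun i => hp.2.1 _, fun i => hp.2.2 (Fin.castSucc i)⟩
  have := hp.1 (tailIdx i)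
  rwa [show (tailIdx i).val = n + 1 + i.val from rfl, phiUpper_tail] at this

theorem contDiffAt_joinParam {E : Type*} [NormedAddCommGroup E] [NormedSpace ℝ E] {x : E} {n : ℕ}
    {a b : E → ℕ → ℝ} {w : E → ℝ} {t : E → EulerParam (n + 1)}
    (ha : ∀ k ≤ n, ContDiffAt ℝ ω (fun y => a y k) x)
    (hb : ∀ k ≤ n, ContDiffAt ℝ ω (fun y => b y k) x) (hw : ContDiffAt ℝ ω w x)
    (ht : ContDiffAt ℝ ω t x) :
    ContDiffAt ℝ ω (fun y => joinParam (a y) (b y) (w y) (t y)) x := by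
  have hjoin : ∀ {a : E → ℕ → ℝ} {t : E → Fin (numAngles (n + 1)) → ℝ},
      (∀ k ≤ n, ContDiffAt ℝ ω (fun y => a y k) x) → ContDiffAt ℝ ω t x →
      ContDiffAt ℝ ω (fun y => joinAngles (n := n) (a y) (t y)) x := fun ha ht => by
    refine contDiffAt_pi.2 fun i => ?_
    by_cases h : i.val < n + 1
    · simp only [joinAngles, h, dif_pos]
      exact ha _ (by omega)
    · simp only [joinAngles, h, dif_neg, not_false_eq_true]
      exact contDiffAt_pi.1 ht _
  refine (hjoin ha ht.fst).prodMk ((hjoin hb ht.snd.fst).prodMk (contDiffAt_pi.2 fun i => ?_))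
  refine Fin.lastCases (n := n) ?_ (fun j => ?_) i
  · simp only [Fin.snoc_last (α := fun _ => ℝ)]
    exact hw
  · simp only [Fin.snoc_castSucc (α := fun _ => ℝ)]
    exact contDiffAt_pi.1 ht.snd.snd j

/-! ### The inductive construction of a section -/

/-- The last column of a matrix as a sequence. -/
def lastColumn {n : ℕ} (M : Matrix (Fin (n + 2)) (Fin (n + 2)) ℂ) (i : ℕ) : ℂ :=
  M (Fin.ofNat (n + 2) i) (Fin.last (n + 1))

open Matrix in
theorem lastColumn_eq {n : ℕ} (M : Matrix (Fin (n + 2)) (Fin (n + 2)) ℂ) :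
    (fun i : Fin (n + 2) => lastColumn M i) = M *ᵥ Pi.single (Fin.last (n + 1)) 1 := by
  ext i
  simp [lastColumn]

open Matrix in
theorem norm_eq_one_of_unitary {N : ℕ} {P M : Matrix (Fin N) (Fin N) ℂ}
    (hP : P ∈ unitaryGroup (Fin N) ℂ) (hM : M ∈ unitaryGroup (Fin N) ℂ) {i : Fin N} {d : ℂ}
    (h : P *ᵥ Pi.single i d = M *ᵥ Pi.single i 1) : ‖d‖ = 1 := by
  have key : ∀ {A : Matrix (Fin N) (Fin N) ℂ}, A ∈ unitaryGroup (Fin N) ℂ → ∀ u : Fin N → ℂ,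
      star (A *ᵥ u) ⬝ᵥ (A *ᵥ u) = star u ⬝ᵥ u := fun hA u => by
    rw [star_mulVec, dotProduct_mulVec, vecMul_vecMul, ← star_eq_conjTranspose,
      mem_unitaryGroup_iff'.1 hA, vecMul_one]
  have h1 := key hP (Pi.single i d)
  rw [h, key hM] at h1
  simp only [dotProduct_single, Pi.star_apply, Pi.single_eq_same, star_one, mul_one] at h1
  have h2 : star d * d = ((‖d‖ ^ 2 : ℝ) : ℂ) := by
    rw [mul_comm, ← starRingEnd_apply, Complex.mul_conj, Complex.normSq_eq_norm_sq]
  rw [h2] at h1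
  have h3 : ‖d‖ ^ 2 = 1 := by exact_mod_cast h1.symm
  exact (pow_eq_one_iff_of_nonneg (norm_nonneg d) two_ne_zero).1 h3

section Section

variable {n : ℕ} (G : Matrix (Fin (n + 1)) (Fin (n + 1)) ℂ → EulerParam (n + 1))
  (M : Matrix (Fin (n + 2)) (Fin (n + 2)) ℂ)

/-- The angles `φ` of the first block, recovered from `M`. -/
noncomputable def recPhi (k : ℕ) : ℝ := (headInv n (lastColumn M) k).1

/-- The angles `ψ` of the first block, recovered from `M`. -/
noncomputable def recPsi (k : ℕ) : ℝ := (headInv n (lastColumn M) k).2.1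

/-- The last angle, recovered from `M`. -/
noncomputable def recOmega : ℝ := lastPhaseInv n (headInv n (lastColumn M) n).2.2

/-- The matrix `M` with the outer factors of the Euler decomposition removed. -/
noncomputable def recMiddle : Matrix (Fin (n + 2)) (Fin (n + 2)) ℂ :=
  star (headProd n (n + 1) (recPhi M) (recPsi M)) * M * star (lastFactor n (recOmega M))

/-- The parameters of `M`, given the inverse `G` of the Euler map in one dimension less. -/
noncomputable def recParam : EulerParam (n + 2) :=
  joinParam (recPhi M) (recPsi M) (recOmega M) (G (corner (recMiddle M)))

theorem recPhi_recPsi_mem (k : ℕ) :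
    recPhi M k ∈ Icc 0 (headUpper k) ∧ recPsi M k ∈ Icc 0 (Real.pi / 2) :=
  headInv_mem n (lastColumn M) k

-- The adjoint of the head product sends the last column of M to d e, and the adjoint of the last
-- factor contributes the conjugate of d. As |d| = 1, the middle matrix fixes e and is therefore a
-- block matrix.
open Matrix in
theorem addOne_corner_recMiddle (hM : M ∈ specialUnitaryGroup (Fin (n + 2)) ℂ) :
    ‖(headInv n (lastColumn M) n).2.2‖ = 1 ∧ addOne (corner (recMiddle M)) = recMiddle M ∧
      recMiddle M ∈ specialUnitaryGroup (Fin (n + 2)) ℂ := by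
  have hP := headProd_mem n (n + 1) le_rfl (recPhi M) (recPsi M)
  have hcol := headProd_headInv n (lastColumn M)
  change headProd n (n + 1) (recPhi M) (recPsi M) *ᵥ _ = _ at hcol
  rw [lastColumn_eq] at hcol
  have hd := norm_eq_one_of_unitary hP.1 hM.1 hcol
  have hw : lastPhase n (recOmega M) = (headInv n (lastColumn M) n).2.2 :=
    (hasSection_lastPhase n).right _ hd
  have hmem : recMiddle M ∈ specialUnitaryGroup (Fin (n + 2)) ℂ :=
    mul_mem (mul_mem (star (⟨_, hP⟩ : specialUnitaryGroup (Fin (n + 2)) ℂ)).2 hM)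
      (star (⟨_, lastFactor_mem n _⟩ : specialUnitaryGroup (Fin (n + 2)) ℂ)).2
  refine ⟨hd, addOne_corner hmem.1 ?_, hmem⟩
  have hs : ∀ c : ℂ, (Pi.single (Fin.last (n + 1)) c : Fin (n + 2) → ℂ) =
      c • Pi.single (Fin.last (n + 1)) 1 := fun c => by
    rw [← Pi.single_smul, smul_eq_mul, mul_one]
  rw [recMiddle, ← mulVec_mulVec, star_lastFactor_mulVec, hw, mul_one, hs, mulVec_smul,
    ← mulVec_mulVec, ← hcol, mulVec_mulVec, mem_unitaryGroup_iff'.1 hP.1, one_mulVec,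
    hs (headInv n (lastColumn M) n).2.2, smul_smul, ← starRingEnd_apply, mul_comm, Complex.mul_conj,
    Complex.normSq_eq_norm_sq, hd]
  simp

theorem hasSection_recParam
    (hG : HasSection (eulerMap (n + 1)) (eulerCube (n + 1)) (openEulerCube (n + 1))
      (Matrix.specialUnitaryGroup (Fin (n + 1)) ℂ) G) :
    HasSection (eulerMap (n + 2)) (eulerCube (n + 2)) (openEulerCube (n + 2))
      (Matrix.specialUnitaryGroup (Fin (n + 2)) ℂ) (recParam G) := by
  have hcorner : ∀ M ∈ Matrix.specialUnitaryGroup (Fin (n + 2)) ℂ,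
      corner (recMiddle M) ∈ Matrix.specialUnitaryGroup (Fin (n + 1)) ℂ := fun M hM => by
    obtain ⟨-, h, hm⟩ := addOne_corner_recMiddle M hM
    rwa [← addOne_mem_iff, h]
  -- On the image of the open cube all recovered data coincide with the original parameters, which
  -- places every ingredient at a point of analyticity.
  have key : ∀ p ∈ openEulerCube (n + 2), recParam G (eulerMap (n + 2) p) = p ∧
      ContDiffAt ℝ ω (recParam G) (eulerMap (n + 2) p) := by
    intro p hp
    set M := eulerMap (n + 2) p
    have hM : M = _ := eulerMap_succ p
    set P := headProd n (n + 1) (headSeq p.1) (headSeq p.2.1) with hPdef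
    set w := p.2.2 (Fin.last n)
    -- The block factor fixes the last basis vector, so the last column of M sees only the first
    -- block of angles and the last phase.
    have hcol : Matrix.mulVec P (Pi.single (Fin.last (n + 1)) (lastPhase n w)) =
        fun i : Fin (n + 2) => lastColumn M i := by
      rw [lastColumn_eq, hM, ← Matrix.mulVec_mulVec, lastFactor_mulVec, mul_one,
        ← Matrix.mulVec_mulVec, addOne_mulVec_last]
    have hwmem : w ∈ Ioo 0 (2 * Real.pi / (n + 1 : ℕ)) := by
      have := hp.2.2 (Fin.last n)
      simpa using this
    have hw0 : lastPhase n w ≠ 0 := Complex.exp_ne_zero _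
    have hspec := fun k (hk : k ≤ n) => headInv_spec (v := lastColumn) (openHead_of_mem hp) hw0 hcol
      (fun i => contDiffAt_matrix.1 contDiffAt_id _ _) hk
    have eφ : ∀ k < n + 1, recPhi M k = headSeq p.1 k := fun k hk => (hspec k (by omega)).1
    have eψ : ∀ k < n + 1, recPsi M k = headSeq p.2.1 k := fun k hk => (hspec k (by omega)).2.1
    have ed := (hspec n le_rfl).2.2.1
    have ew : recOmega M = w := by
      rw [recOmega, ed, (hasSection_lastPhase n).left _ hwmem]
    have eB : recMiddle M = addOne (eulerMap (n + 1) (eulerTail p)) := by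
      rw [recMiddle, headProd_congr eφ eψ, ew, ← hPdef, hM, mul_assoc, mul_assoc, mul_assoc,
        Matrix.mem_unitaryGroup_iff.1 (lastFactor_mem n w).1, mul_one, ← mul_assoc,
        Matrix.mem_unitaryGroup_iff'.1 (headProd_mem n (n + 1) le_rfl _ _).1, one_mul]
    have eC : corner (recMiddle M) = eulerMap (n + 1) (eulerTail p) := by
      rw [eB, corner_addOne]
    refine ⟨?_, ?_⟩
    · rw [recParam, eC, hG.left _ (eulerTail_mem hp), ew]
      exact joinParam_self p eφ eψ
    · have sφ : ∀ k ≤ n, ContDiffAt ℝ ω (fun y => recPhi y k) M :=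
        fun k hk => (hspec k hk).2.2.2.fst
      have sψ : ∀ k ≤ n, ContDiffAt ℝ ω (fun y => recPsi y k) M :=
        fun k hk => (hspec k hk).2.2.2.snd.fst
      have sw : ContDiffAt ℝ ω recOmega M := by
        have h := (hasSection_lastPhase n).smooth w hwmem
        rw [← ed] at h
        exact h.comp M (hspec n le_rfl).2.2.2.snd.snd
      have sB : ContDiffAt ℝ ω recMiddle M :=
        ((contDiffAt_headProd le_rfl (fun k hk => sφ k (by omega))
          fun k hk => sψ k (by omega)).matrix_star.matrix_mul contDiffAt_id).matrix_mul
          (contDiffAt_exp_suGenerator_diag (j := n + 1) (by omega) sw).matrix_star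
      have sG := hG.smooth _ (eulerTail_mem hp)
      rw [← eC] at sG
      exact contDiffAt_joinParam sφ sψ sw (sG.comp M (contDiffAt_corner sB))
  refine ⟨fun M hM => ?_, fun M hM => ?_, fun p hp => (key p hp).1, fun p hp => (key p hp).2⟩
  · exact joinParam_mem (fun k => (recPhi_recPsi_mem M k).1) (fun k => (recPhi_recPsi_mem M k).2)
      ((hasSection_lastPhase n).mapsTo (addOne_corner_recMiddle M hM).1) (hG.mapsTo (hcorner M hM))
  · rw [recParam, eulerMap_joinParam, hG.right _ (hcorner M hM), (addOne_corner_recMiddle M hM).2.1,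
      recMiddle, mul_assoc, mul_assoc,
      Matrix.mem_unitaryGroup_iff'.1 (lastFactor_mem n (recOmega M)).1, mul_one, ← mul_assoc,
      Matrix.mem_unitaryGroup_iff.1 (headProd_mem n (n + 1) le_rfl _ _).1, one_mul]

end Section

theorem exists_hasSection_eulerMap (n : ℕ) : ∃ G, HasSection (eulerMap (n + 1)) (eulerCube (n + 1))
    (openEulerCube (n + 1)) (Matrix.specialUnitaryGroup (Fin (n + 1)) ℂ) G := by
  induction n with
  | zero =>
    -- SU(1) is trivial and its parameter space is a single point.
    refine ⟨fun _ => 0, fun M _ => ?_, fun M hM => ?_, fun p _ => ?_, fun p _ => contDiffAt_const⟩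
    · exact ⟨fun i => i.elim0, fun i => i.elim0, fun i => i.elim0⟩
    · have h := (Matrix.mem_specialUnitaryGroup_iff.1 hM).2
      rw [Matrix.det_fin_one] at h
      ext i j
      rw [show i = 0 from Fin.ext (by omega), show j = 0 from Fin.ext (by omega), h]
      rfl
    · refine Prod.ext (funext fun i => i.elim0) (Prod.ext (funext fun i => i.elim0)
        (funext fun i => i.elim0))
  | succ n ih =>
    obtain ⟨G, hG⟩ := ih
    exact ⟨_, hasSection_recParam G hG⟩

/-! ### From the section to the diffeomorphism -/

/-- An analytic map that has a section over `L`, analytic along the image of an open set `O`,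
restricts to a diffeomorphism of `O` onto a relatively open subset of `L`. -/
theorem HasSection.exists_isDiffeoOnto {E F : Type*} [NormedAddCommGroup E] [NormedSpace ℝ E]
    [NormedAddCommGroup F] [NormedSpace ℝ F] {f : E → F} {K O : Set E} {L : Set F} {g : F → E}
    (h : HasSection f K O L g) (hf : ContDiff ℝ ω f) (hO : IsOpen O) (hL : MapsTo f O L) :
    ∃ V : Set L, IsOpen V ∧ IsDiffeoOnto f O ((↑) '' V) := by
  have himg : (↑) '' ((↑) ⁻¹' (f '' O) : Set L) = f '' O := by
    rw [Subtype.image_preimage_coe, inter_eq_right]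
    exact hL.image_subset
  refine ⟨(↑) ⁻¹' (f '' O), isOpen_iff_mem_nhds.2 ?_, ?_⟩
  · rintro ⟨y, hy⟩ ⟨p, hp, rfl⟩
    have hc : ContinuousAt (fun z : L => g z) ⟨f p, hy⟩ :=
      ContinuousAt.comp (f := ((↑) : L → F)) (h.smooth p hp).continuousAt
        continuous_subtype_val.continuousAt
    -- Near f p the continuous section takes values in O, and z = f (g z) then puts z in the image
    -- of O.
    filter_upwards [hc.preimage_mem_nhds (hO.mem_nhds (by rwa [h.left p hp]))] with z hz
    exact ⟨g z, hz, h.right z z.2⟩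
  · rw [himg]
    have hinj : InjOn f O := fun p hp q hq e => by rw [← h.left p hp, e, h.left q hq]
    refine ⟨hinj.bijOn_image, fun x _ => ⟨univ, isOpen_univ, mem_univ x, f,
      (hf.of_le le_top).contDiffOn, fun _ _ => rfl⟩, g, ⟨fun p hp => h.left p hp, ?_⟩, ?_⟩
    · rintro _ ⟨p, hp, rfl⟩
      rw [h.left p hp]
    · rintro _ ⟨p, hp, rfl⟩
      -- Analyticity at a point spreads to a neighbourhood. `ContDiffAt` of order ∞ would not
      -- suffice, since its neighbourhoods may shrink with the order of differentiation.
      obtain ⟨U, hU, hUo, hpU⟩ := eventually_nhds_iff.1 ((h.smooth p hp).eventually (by simp))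
      exact ⟨U, hUo, hpU, g, fun y hy => ((hU y hy).of_le le_top).contDiffWithinAt, fun _ _ => rfl⟩

theorem mainTheorem3 (N : ℕ) (hN : 2 ≤ N) :
    Set.MapsTo (eulerMap N) (eulerCube N)
        (Matrix.specialUnitaryGroup (Fin N) ℂ : Set (Matrix (Fin N) (Fin N) ℂ)) ∧
      Set.SurjOn (eulerMap N) (eulerCube N)
        (Matrix.specialUnitaryGroup (Fin N) ℂ : Set (Matrix (Fin N) (Fin N) ℂ)) ∧
      ∃ V : Set (Matrix.specialUnitaryGroup (Fin N) ℂ), IsOpen V ∧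
        IsDiffeoOnto (eulerMap N) (interior (eulerCube N))
          ((↑) '' V : Set (Matrix (Fin N) (Fin N) ℂ)) := by
  obtain ⟨n, rfl⟩ : ∃ n, N = n + 1 := ⟨N - 1, by omega⟩
  obtain ⟨G, hG⟩ := exists_hasSection_eulerMap n
  have hI := interior_eulerCube_subset (n + 1)
  have hG' : HasSection (eulerMap (n + 1)) (eulerCube (n + 1)) (interior (eulerCube (n + 1)))
      (Matrix.specialUnitaryGroup (Fin (n + 1)) ℂ) G :=
    ⟨hG.mapsTo, hG.right, fun p hp => hG.left p (hI hp), fun p hp => hG.smooth p (hI hp)⟩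
  exact ⟨fun p _ => eulerMap_mem n p, fun M hM => ⟨G M, hG.mapsTo hM, hG.right M hM⟩,
    hG'.exists_isDiffeoOnto (contDiff_eulerMap n) isOpen_interior fun p _ => eulerMap_mem n p⟩
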